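/- Let $\mathrm{Sol}_3$ be $\mathbb{R}^3$ with the Riemannian metric $\langle\cdot,\cdot\rangle=e^{2z}dx^2+e^{-2z}dy^2+dz^2$ and the orthonormal frame $E_1=e^{-z}\partial_x$, $E_2=e^{z}\partial_y$, $E_3=\partial_z$, and let $\bar\nabla$ be its Levi-Civita connection. Let $\phi:\Sigma^2\to\mathrm{Sol}_3$ be a smooth immersion of a surface without boundary, equipped with the induced metric and the induced connection $\nabla$, and let $\xi$ be a smooth unit normal vector field. Let $A$ be the shape operator, $\bar\nabla_X\xi=-AX$, let $f=\frac12\operatorname{trace}A$ be the mean curvature function, let $|A|$ be the norm of $A$ in the induced metric, and let $X^\top$ and $X^\perp$ be the tangent and normal parts of a vector $X$ of $\mathrm{Sol}_3$ along the surface. Let $\operatorname{grad}$ be the gradient, $\operatorname{Div}X=\operatorname{trace}(\nabla X)$ the divergence and $\Delta=\operatorname{Div}\operatorname{grad}$ the Laplacian on $\Sigma^2$. Then, at every point of $\Sigma^2$, $$ \begin{aligned} \tfrac12\Delta\langle\xi,E_3^{\perp}\rangle^2={}&-\operatorname{Div}\big(f\langle\xi,E_3^{\perp}\rangle E_3^{\top}\big)-\langle\xi,E_3^{\perp}\rangle\langle\operatorname{grad}f,E_3^{\top}\rangle\\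 &+2\langle\xi,E_3^{\perp}\rangle\langle AE_2^{\top},E_2^{\top}\rangle-2\langle\xi,E_3^{\perp}\rangle\langle AE_1^{\top},E_1^{\top}\rangle\\ &+2\langle\xi,E_2^{\perp}\rangle\langle AE_3^{\top},E_2^{\top}\rangle-2\langle\xi,E_1^{\perp}\rangle\langle AE_3^{\top},E_1^{\top}\rangle\\ &+\langle\xi,E_3^{\perp}\rangle^2\,(2f^2-3-|A|^2)-f\langle AE_3^{\top},E_3^{\top}\rangle+\langle AE_3^{\top},AE_3^{\top}\rangle\\ &+1-\big(\langle\xi,E_2^{\perp}\rangle^2-\langle\xi,E_1^{\perp}\rangle^2\big)^2 . \end{aligned} $$ -/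

import Mathlib

open scoped Manifold ContDiff

noncomputable section

/-- The underlying manifold `ℝ³` of the Lie group `Sol₃`, with its global coordinates
`x = p 0`, `y = p 1`, `z = p 2`. Tangent vectors at every point are identified with `ℝ³` through
the coordinate frame `∂/∂x, ∂/∂y, ∂/∂z`. -/
abbrev Sol3 : Type := Fin 3 → ℝ

namespace Sol3

/-! ### The ambient Riemannian manifold -/

/-- The matrix of the metric `e^{2z} dx² + e^{-2z} dy² + dz²` in the coordinates `(x, y, z)`. -/
def metricMatrix (p : Sol3) : Matrix (Fin 3) (Fin 3) ℝ :=
  Matrix.diagonal ![Real.exp (2 * p 2), Real.exp (-(2 * p 2)), 1]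

/-- The Riemannian metric of `Sol₃` at `p`, as a bilinear form on tangent vectors. -/
def metric (p : Sol3) : Sol3 →ₗ[ℝ] Sol3 →ₗ[ℝ] ℝ :=
  Matrix.toLinearMap₂' ℝ (metricMatrix p)

/-- The canonical left-invariant orthonormal frame: `E 0 = e^{-z} ∂/∂x`, `E 1 = e^z ∂/∂y`,
`E 2 = ∂/∂z` (the fields usually numbered `E₁, E₂, E₃`). -/
def E (k : Fin 3) (p : Sol3) : Sol3 :=
  Pi.single k ((![Real.exp (-(p 2)), Real.exp (p 2), 1] : Fin 3 → ℝ) k)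

/-- The partial derivative `∂_k g_{ij}` of a coefficient of the metric. -/
def dMetric (p : Sol3) (k i j : Fin 3) : ℝ :=
  fderiv ℝ (fun q : Sol3 => metricMatrix q i j) p (Pi.single k 1)

/-- The Christoffel symbol `Γ^k_{ij} = ½ ∑_l g^{kl} (∂_i g_{jl} + ∂_j g_{il} - ∂_l g_{ij})` of the
Levi-Civita connection of `Sol₃`. -/
def christoffel (p : Sol3) (k i j : Fin 3) : ℝ :=
  (1 / 2) * ∑ l, (metricMatrix p)⁻¹ k l * (dMetric p i j l + dMetric p j i l - dMetric p l i j)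

/-- The linear map `v ↦ (∑_{i,j} Γ^k_{ij} v^i w^j)_k`. -/
def christoffelMap (p w : Sol3) : Sol3 →ₗ[ℝ] Sol3 :=
  Matrix.toLin' (Matrix.of fun k i => ∑ j, christoffel p k i j * w j)

end Sol3

/-! ### Immersed surfaces in `Sol₃`

Below `M` is a surface and `φ : M → Sol3` a map (an immersion, in all uses). -/

namespace SolSurface

variable {M : Type*} [TopologicalSpace M] [ChartedSpace (EuclideanSpace ℝ (Fin 2)) M]

/-- The differential `dφ_p : T_p M → T_{φ(p)} Sol₃ = ℝ³`. -/
def differential (φ : M → Sol3) (p : M) : TangentSpace (𝓡 2) p →ₗ[ℝ] Sol3 :=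
  (mfderiv (𝓡 2) 𝓘(ℝ, Sol3) φ p).toLinearMap

/-- The covariant derivative `∇̄_v W` of a vector field `W` along `φ` in the direction of
`v ∈ T_p M`, for the Levi-Civita connection `∇̄` of `Sol₃`; in coordinates it is
`dW^k(v) + ∑_{i,j} Γ^k_{ij} dφ(v)^i W^j`. -/
def covDerivAlong (φ : M → Sol3) (W : M → Sol3) (p : M) : TangentSpace (𝓡 2) p →ₗ[ℝ] Sol3 :=
  differential W p + (Sol3.christoffelMap (φ p) (W p)).comp (differential φ p)

/-- The metric induced by `φ` on `M`. -/
def inducedMetric (φ : M → Sol3) (p : M) :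
    TangentSpace (𝓡 2) p →ₗ[ℝ] TangentSpace (𝓡 2) p →ₗ[ℝ] ℝ :=
  (Sol3.metric (φ p)).compl₁₂ (differential φ p) (differential φ p)

/-- The musical isomorphism `♯` of the induced metric: for an immersion, `sharp φ p α` is the
vector `v` with `⟨v, w⟩ = α w` for all `w ∈ T_p M`. -/
def sharp (φ : M → Sol3) (p : M) :
    (TangentSpace (𝓡 2) p →ₗ[ℝ] ℝ) →ₗ[ℝ] TangentSpace (𝓡 2) p :=
  (inducedMetric φ p).leftInverse

/-- The tangent part `W^⊤ ∈ T_p M` of a vector `W` of `Sol₃` at `φ p`: the vector with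
`⟨W^⊤, w⟩ = ⟨W, dφ w⟩` for all `w ∈ T_p M`. -/
def tangentPart (φ : M → Sol3) (p : M) : Sol3 →ₗ[ℝ] TangentSpace (𝓡 2) p :=
  (sharp φ p).comp ((Sol3.metric (φ p)).compl₁₂ LinearMap.id (differential φ p))

/-- The normal part `W^⊥ = W - dφ (W^⊤)`. -/
def normalPart (φ : M → Sol3) (p : M) (W : Sol3) : Sol3 :=
  W - differential φ p (tangentPart φ p W)

/-- The tangent part `E_k^⊤` of a field of the canonical frame, a tangent vector field on `M`. -/
def ETan (φ : M → Sol3) (k : Fin 3) (p : M) : TangentSpace (𝓡 2) p :=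
  tangentPart φ p (Sol3.E k (φ p))

/-- The function `⟨ξ, E_k^⊥⟩` on `M`. -/
def angle (φ ξ : M → Sol3) (k : Fin 3) (p : M) : ℝ :=
  Sol3.metric (φ p) (ξ p) (normalPart φ p (Sol3.E k (φ p)))

/-- `ξ` is a smooth unit vector field along `φ`, normal to the surface. -/
structure IsUnitNormal (φ ξ : M → Sol3) : Prop where
  smooth : ContMDiff (𝓡 2) 𝓘(ℝ, Sol3) ∞ ξ
  unit : ∀ p, Sol3.metric (φ p) (ξ p) (ξ p) = 1
  normal : ∀ p v, Sol3.metric (φ p) (ξ p) (differential φ p v) = 0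

/-- The shape operator, `A v = -(∇̄_v ξ)^⊤`. For a unit normal `ξ` the vector `∇̄_v ξ` is tangent
to the surface, so this is the equation `∇̄_v ξ = -A v`. -/
def shapeOperator (φ ξ : M → Sol3) (p : M) :
    TangentSpace (𝓡 2) p →ₗ[ℝ] TangentSpace (𝓡 2) p :=
  -((tangentPart φ p).comp (covDerivAlong φ ξ p))

/-- The mean curvature function `f = ½ trace A`. -/
def meanCurvature (φ ξ : M → Sol3) (p : M) : ℝ :=
  (1 / 2) * LinearMap.trace ℝ (TangentSpace (𝓡 2) p) (shapeOperator φ ξ p)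

/-- The squared norm `|L|² = trace (L* L)` of an endomorphism of `T_p M`, the adjoint `L*` and the
norm being those of the induced metric; equivalently `∑ |L e_i|²` over an orthonormal basis. -/
def normSq (φ : M → Sol3) (p : M) (L : TangentSpace (𝓡 2) p →ₗ[ℝ] TangentSpace (𝓡 2) p) : ℝ :=
  LinearMap.trace ℝ (TangentSpace (𝓡 2) p)
    ((sharp φ p).comp ((inducedMetric φ p).compl₁₂ L L))

/-- The gradient of a function on `M` for the induced metric. -/
def grad (φ : M → Sol3) (u : M → ℝ) (p : M) : TangentSpace (𝓡 2) p :=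
  sharp φ p (mfderiv (𝓡 2) 𝓘(ℝ, ℝ) u p).toLinearMap

/-- The induced (Levi-Civita) connection of the surface, given by the Gauss equation as
`∇_v X = (∇̄_v dφ(X))^⊤`; it is linear in `v ∈ T_p M`. -/
def inducedConnection (φ : M → Sol3) (X : ∀ q : M, TangentSpace (𝓡 2) q) (p : M) :
    TangentSpace (𝓡 2) p →ₗ[ℝ] TangentSpace (𝓡 2) p :=
  (tangentPart φ p).comp (covDerivAlong φ (fun q => differential φ q (X q)) p)

/-- The divergence `Div X = trace (v ↦ ∇_v X)` of a tangent vector field on the surface. -/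
def divergence (φ : M → Sol3) (X : ∀ q : M, TangentSpace (𝓡 2) q) (p : M) : ℝ :=
  LinearMap.trace ℝ (TangentSpace (𝓡 2) p) (inducedConnection φ X p)

/-- The Laplacian `Δ u = Div (grad u)` of the surface. -/
def laplacian (φ : M → Sol3) (u : M → ℝ) (p : M) : ℝ :=
  divergence φ (grad φ u) p

end SolSurface

end

/-! Write ν_k = ⟨ξ, E_k⟩ and T_k for the tangent part of E_k. The theorem is ½Δν₃² = |grad ν₃|² +
ν₃Δν₃ with both terms computed. Since ∇̄_v E₃ = v¹E₁ - v²E₂, one has grad ν₃ = -AT₃ + ν₁T₁ - ν₂T₂.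
Its square, with ⟨T_k, T_l⟩ = δ_kl - ν_kν_l, is `angle_gradient_algebra`. A further derivative needs
div A, which the Codazzi equation turns into 2 grad f plus a curvature term; this gives Δν₃ =
-2⟨grad f, T₃⟩ - ν₃(2 + |A|²) + 2f(ν₁² - ν₂²) - 2⟨AT₁, T₁⟩ + 2⟨AT₂, T₂⟩ (`angle_laplacian_algebra`).
Finally Div(fν₃T₃) is expanded with Div T₃ = |T₁|² - |T₂|² + 2fν₃; it absorbs one of the two copies
of ν₃⟨grad f, T₃⟩ (`angle_sq_algebra`).

In the frame E the metric is the dot product of ℝ³ and the connection has constant coefficients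
(`framedDeriv_toFrame`), so the geometry becomes calculus of ℝ³-valued functions on a chart. The
coordinate directions are chosen to be orthonormal at the given point only. Hence the derivatives of
the coordinate fields do not vanish there; they are carried along until they cancel.
`bochner_angle_sq` is the formula in this language, and the last part translates it back to the
surface. -/

noncomputable section

/-! ### Metric and connection of Sol₃ in the left-invariant frame -/

namespace Sol3

/-- The components of a tangent vector at `p` in the orthonormal frame `E`. -/
def toFrame (p : Sol3) : Sol3 →ₗ[ℝ] Sol3 :=
  Matrix.toLin' (Matrix.diagonal ![Real.exp (p 2), Real.exp (-(p 2)), 1])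

theorem toFrame_apply (p W : Sol3) :
    toFrame p W = ![Real.exp (p 2) * W 0, Real.exp (-(p 2)) * W 1, W 2] := by
  ext i
  fin_cases i <;> simp [toFrame, Matrix.mulVec_diagonal]

@[simp] theorem toFrame_apply_zero (p W : Sol3) : toFrame p W 0 = Real.exp (p 2) * W 0 := by
  simp [toFrame_apply]

@[simp] theorem toFrame_apply_one (p W : Sol3) : toFrame p W 1 = Real.exp (-(p 2)) * W 1 := by
  simp [toFrame_apply]

@[simp] theorem toFrame_apply_two (p W : Sol3) : toFrame p W 2 = W 2 := by
  simp [toFrame_apply]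

theorem toFrame_injective (p : Sol3) : Function.Injective (toFrame p) := by
  intro u v h
  have h0 := congrFun h 0
  have h1 := congrFun h 1
  have h2 := congrFun h 2
  simp only [toFrame_apply_zero, toFrame_apply_one, toFrame_apply_two] at h0 h1 h2
  ext i
  fin_cases i
  · exact mul_left_cancel₀ (Real.exp_ne_zero _) h0
  · exact mul_left_cancel₀ (Real.exp_ne_zero _) h1
  · exact h2

theorem toFrame_E (p : Sol3) (k : Fin 3) : toFrame p (E k p) = Pi.single k 1 := by
  ext i
  fin_cases k <;> fin_cases i <;> simp [E, ← Real.exp_add]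

theorem exp_two_mul_eq (z : ℝ) : Real.exp (2 * z) = Real.exp z * Real.exp z := by
  rw [← Real.exp_add, two_mul]

theorem metric_eq_dotProduct (p u v : Sol3) : metric p u v = toFrame p u ⬝ᵥ toFrame p v := by
  have h : Real.exp (-(2 * p 2)) = Real.exp (-(p 2)) * Real.exp (-(p 2)) := by
    rw [← exp_two_mul_eq]; ring_nf
  simp only [metric, metricMatrix, Matrix.toLinearMap₂'_apply', Matrix.mulVec_diagonal,
    dotProduct, Fin.sum_univ_three, toFrame_apply]
  simp [h, exp_two_mul_eq]
  ring

theorem metric_comm (p u v : Sol3) : metric p u v = metric p v u := by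
  rw [metric_eq_dotProduct, metric_eq_dotProduct, dotProduct_comm]

theorem eq_zero_of_metric_self_eq_zero {p u : Sol3} (h : metric p u u = 0) : u = 0 := by
  rw [metric_eq_dotProduct, dotProduct_self_eq_zero] at h
  exact toFrame_injective p (by simpa using h)

theorem metric_self_pos {p u : Sol3} (h : u ≠ 0) : 0 < metric p u u := by
  refine lt_of_le_of_ne ?_ fun h' => h (eq_zero_of_metric_self_eq_zero h'.symm)
  rw [metric_eq_dotProduct]
  exact Finset.sum_nonneg fun i _ => mul_self_nonneg _

/-- The Levi-Civita connection in the frame `E`: the components of `∇̄_a w` for vector fields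
with constant components `a`, `w`. -/
def frameConnection (a w : Sol3) : Sol3 :=
  ![a 0 * w 2, -(a 1 * w 2), -(a 0 * w 0) + a 1 * w 1]

theorem dMetric_eq (p : Sol3) (k i j : Fin 3) : dMetric p k i j =
    if k = 2 ∧ i = j then
      (![2 * Real.exp (2 * p 2), -(2 * Real.exp (-(2 * p 2))), 0] : Fin 3 → ℝ) i else 0 := by
  have hp : ∀ k : Fin 3, HasFDerivAt (fun q : Sol3 => q k)
      (ContinuousLinearMap.proj (R := ℝ) (φ := fun _ : Fin 3 => ℝ) k) p := fun k =>
    (ContinuousLinearMap.proj (R := ℝ) (φ := fun _ : Fin 3 => ℝ) k).hasFDerivAt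
  have h0 := ((hp 2).const_mul 2).exp.fderiv
  have h1 := ((hp 2).const_mul 2).fun_neg.exp.fderiv
  unfold dMetric metricMatrix
  fin_cases i <;> fin_cases j <;> simp [Matrix.diagonal, h0, h1] <;> fin_cases k <;> simp <;> ring

theorem inv_metricMatrix (p : Sol3) : (metricMatrix p)⁻¹ =
    Matrix.diagonal ![Real.exp (-(2 * p 2)), Real.exp (2 * p 2), 1] := by
  apply Matrix.inv_eq_right_inv
  rw [metricMatrix, Matrix.diagonal_mul_diagonal, ← Matrix.diagonal_one]
  congr 1
  ext i
  fin_cases i <;> simp [← Real.exp_add]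

theorem christoffelMap_apply (p w v : Sol3) : christoffelMap p w v =
    ![v 0 * w 2 + v 2 * w 0, -(v 1 * w 2 + v 2 * w 1),
      -(Real.exp (2 * p 2) * (v 0 * w 0)) + Real.exp (-(2 * p 2)) * (v 1 * w 1)] := by
  have h : Real.exp (2 * p 2) * Real.exp (-(2 * p 2)) = 1 := by simp [← Real.exp_add]
  have h' : Real.exp (-(2 * p 2)) * Real.exp (2 * p 2) = 1 := by simp [← Real.exp_add]
  ext i
  fin_cases i
  all_goals
    simp [christoffelMap, Matrix.mulVec, dotProduct, Fin.sum_univ_three, christoffel,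
      inv_metricMatrix, dMetric_eq, Matrix.diagonal]
  · linear_combination (w 2 * v 0 + w 0 * v 2) * h'
  · linear_combination (-w 2 * v 1 - w 1 * v 2) * h
  · ring

end Sol3

/-! ### Linear algebra of a plane with an inner product -/

/-- The trace of an endomorphism of a plane in terms of the Gram matrix of a basis. -/
theorem LinearMap.trace_mul_gram_eq {V : Type*} [AddCommGroup V] [Module ℝ V]
    (g : V →ₗ[ℝ] V →ₗ[ℝ] ℝ) (hg : ∀ u v, g u v = g v u) (b : Module.Basis (Fin 2) ℝ V)
    (L : V →ₗ[ℝ] V) :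
    LinearMap.trace ℝ V L * (g (b 0) (b 0) * g (b 1) (b 1) - g (b 0) (b 1) ^ 2) =
      g (b 1) (b 1) * g (L (b 0)) (b 0) - g (b 0) (b 1) * (g (L (b 0)) (b 1) + g (L (b 1)) (b 0))
        + g (b 0) (b 0) * g (L (b 1)) (b 1) := by
  -- The identity is tr(G⁻¹H) · det G = tr(adj(G) H) for 2 × 2 matrices; keeping det G on the left
  -- avoids any division.
  have h0 := b.sum_repr (L (b 0))
  have h1 := b.sum_repr (L (b 1))
  rw [Fin.sum_univ_two] at h0 h1
  rw [LinearMap.trace_eq_matrix_trace ℝ b, Matrix.trace_fin_two, LinearMap.toMatrix_apply,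
    LinearMap.toMatrix_apply, ← h0, ← h1]
  simp [hg (b 1) (b 0)]
  ring

/-- The trace of an endomorphism of a plane in terms of an orthonormal basis. -/
theorem LinearMap.trace_eq_of_orthonormal {V : Type*} [AddCommGroup V] [Module ℝ V]
    (g : V →ₗ[ℝ] V →ₗ[ℝ] ℝ) (hg : ∀ u v, g u v = g v u) (b : Module.Basis (Fin 2) ℝ V)
    (h0 : g (b 0) (b 0) = 1) (h1 : g (b 1) (b 1) = 1) (h01 : g (b 0) (b 1) = 0)
    (L : V →ₗ[ℝ] V) :
    LinearMap.trace ℝ V L = g (L (b 0)) (b 0) + g (L (b 1)) (b 1) := by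
  have h := LinearMap.trace_mul_gram_eq g hg b L
  rw [h0, h1, h01] at h
  linarith

/-- A positive definite bilinear form on a plane has an orthonormal basis. -/
theorem LinearMap.exists_orthonormal_basis_fin_two {V : Type*} [AddCommGroup V] [Module ℝ V]
    [FiniteDimensional ℝ V] (hV : Module.finrank ℝ V = 2)
    (g : V →ₗ[ℝ] V →ₗ[ℝ] ℝ) (hg : ∀ u v, g u v = g v u) (hpos : ∀ v, v ≠ 0 → 0 < g v v) :
    ∃ b : Module.Basis (Fin 2) ℝ V,
      g (b 0) (b 0) = 1 ∧ g (b 1) (b 1) = 1 ∧ g (b 0) (b 1) = 0 := by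
  have hsymm : LinearMap.IsSymm g := ⟨fun u v => by simpa using hg u v⟩
  obtain ⟨c, hc⟩ := LinearMap.BilinForm.exists_orthogonal_basis hsymm
  let c' := c.reindex (finCongr hV)
  have hc' : g (c' 0) (c' 1) = 0 := by
    simp only [c', Module.Basis.reindex_apply]
    exact hc (by simp)
  have hr : ∀ i, 0 < g (c' i) (c' i) := fun i => hpos _ (c'.ne_zero i)
  have hu : ∀ i, IsUnit (Real.sqrt (g (c' i) (c' i)))⁻¹ := fun i =>
    (inv_ne_zero (Real.sqrt_pos.2 (hr i)).ne').isUnit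
  have key : ∀ i, (Real.sqrt (g (c' i) (c' i)))⁻¹ * ((Real.sqrt (g (c' i) (c' i)))⁻¹ *
      g (c' i) (c' i)) = 1 := fun i => by
    have h1 := (Real.sqrt_pos.2 (hr i)).ne'
    have h2 := Real.mul_self_sqrt (hr i).le
    field_simp
    linarith
  refine ⟨c'.isUnitSMul hu, ?_, ?_, ?_⟩
  · simpa [Module.Basis.isUnitSMul_apply] using key 0
  · simpa [Module.Basis.isUnitSMul_apply] using key 1
  · simp [Module.Basis.isUnitSMul_apply, hc']

/-! ### Induced metric, ♯ and tangential projection of an immersion -/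

namespace SolSurface

open Sol3

variable {M : Type*} [TopologicalSpace M] [ChartedSpace (EuclideanSpace ℝ (Fin 2)) M]

instance (p : M) : FiniteDimensional ℝ (TangentSpace (𝓡 2) p) :=
  inferInstanceAs (FiniteDimensional ℝ (EuclideanSpace ℝ (Fin 2)))

theorem finrank_tangentSpace (p : M) : Module.finrank ℝ (TangentSpace (𝓡 2) p) = 2 :=
  finrank_euclideanSpace_fin (𝕜 := ℝ) (n := 2)

theorem inducedMetric_apply (φ : M → Sol3) (p : M) (v w : TangentSpace (𝓡 2) p) :
    inducedMetric φ p v w = metric (φ p) (differential φ p v) (differential φ p w) := rfl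

theorem inducedMetric_comm (φ : M → Sol3) (p : M) (v w : TangentSpace (𝓡 2) p) :
    inducedMetric φ p v w = inducedMetric φ p w v := metric_comm _ _ _

section Immersion

variable {φ : M → Sol3} {p : M} (himm : Function.Injective (differential φ p))
include himm

theorem inducedMetric_self_pos (v : TangentSpace (𝓡 2) p) (hv : v ≠ 0) :
    0 < inducedMetric φ p v v :=
  metric_self_pos fun h => hv (himm (by simpa using h))

theorem inducedMetric_injective : Function.Injective (inducedMetric φ p) := by
  rw [injective_iff_map_eq_zero]
  intro v hv
  by_contra h
  have := inducedMetric_self_pos himm v h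
  simp [hv] at this

theorem inducedMetric_sharp (α : TangentSpace (𝓡 2) p →ₗ[ℝ] ℝ) (v : TangentSpace (𝓡 2) p) :
    inducedMetric φ p (sharp φ p α) v = α v := by
  have hinj := inducedMetric_injective himm
  -- `leftInverse` is a two-sided inverse here: v ↦ ⟨v, ·⟩ is injective between spaces of equal
  -- finite dimension.
  have hsurj : Function.Surjective (inducedMetric φ p) :=
    (LinearMap.injective_iff_surjective_of_finrank_eq_finrank
      (Subspace.dual_finrank_eq (K := ℝ)).symm).1 hinj
  obtain ⟨w, rfl⟩ := hsurj α
  rw [sharp, LinearMap.leftInverse_apply_of_inj (LinearMap.ker_eq_bot.2 hinj)]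

theorem inducedMetric_tangentPart (W : Sol3) (v : TangentSpace (𝓡 2) p) :
    inducedMetric φ p (tangentPart φ p W) v = metric (φ p) W (differential φ p v) :=
  inducedMetric_sharp himm _ v

theorem inducedMetric_grad (u : M → ℝ) (v : TangentSpace (𝓡 2) p) :
    inducedMetric φ p (grad φ u p) v = mfderiv (𝓡 2) 𝓘(ℝ, ℝ) u p v :=
  inducedMetric_sharp himm _ v

theorem normSq_eq_of_orthonormal (b : Module.Basis (Fin 2) ℝ (TangentSpace (𝓡 2) p))
    (h0 : inducedMetric φ p (b 0) (b 0) = 1) (h1 : inducedMetric φ p (b 1) (b 1) = 1)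
    (h01 : inducedMetric φ p (b 0) (b 1) = 0)
    (L : TangentSpace (𝓡 2) p →ₗ[ℝ] TangentSpace (𝓡 2) p) :
    normSq φ p L = inducedMetric φ p (L (b 0)) (L (b 0)) +
      inducedMetric φ p (L (b 1)) (L (b 1)) := by
  rw [normSq, LinearMap.trace_eq_of_orthonormal _ (inducedMetric_comm φ p) b h0 h1 h01]
  simp [inducedMetric_sharp himm]

theorem divergence_eq_of_orthonormal (b : Module.Basis (Fin 2) ℝ (TangentSpace (𝓡 2) p))
    (h0 : inducedMetric φ p (b 0) (b 0) = 1) (h1 : inducedMetric φ p (b 1) (b 1) = 1)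
    (h01 : inducedMetric φ p (b 0) (b 1) = 0) (X : ∀ q : M, TangentSpace (𝓡 2) q) :
    divergence φ X p =
      metric (φ p) (covDerivAlong φ (fun q => differential φ q (X q)) p (b 0))
        (differential φ p (b 0)) +
      metric (φ p) (covDerivAlong φ (fun q => differential φ q (X q)) p (b 1))
        (differential φ p (b 1)) := by
  rw [divergence, LinearMap.trace_eq_of_orthonormal _ (inducedMetric_comm φ p) b h0 h1 h01]
  simp [inducedConnection, inducedMetric_tangentPart himm]

theorem tangentPart_normal {N : Sol3}
    (hnormal : ∀ v, metric (φ p) N (differential φ p v) = 0) : tangentPart φ p N = 0 := by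
  apply inducedMetric_injective himm
  ext v
  simp [inducedMetric_tangentPart himm, hnormal]

variable {N : Sol3} (hunit : metric (φ p) N N = 1)
  (hnormal : ∀ v, metric (φ p) N (differential φ p v) = 0)
include hunit hnormal

/-- A vector along an immersed surface that is orthogonal to the tangent plane and to the unit
normal vanishes. -/
theorem eq_zero_of_orthogonal {W : Sol3} (hN : metric (φ p) N W = 0)
    (hT : ∀ v, metric (φ p) W (differential φ p v) = 0) : W = 0 := by
  -- As 2 + 1 = 3, injectivity makes T_pM ⊕ ℝN all of ℝ³. So W is a combination of vectors
  -- orthogonal to W, and ⟨W, W⟩ = 0.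
  let Ψ : (TangentSpace (𝓡 2) p × ℝ) →ₗ[ℝ] Sol3 :=
    (differential φ p).coprod (LinearMap.toSpanSingleton ℝ Sol3 N)
  have hΨ : ∀ v t, Ψ (v, t) = differential φ p v + t • N := fun v t => by simp [Ψ]
  have hinj : Function.Injective Ψ := by
    rw [injective_iff_map_eq_zero]
    rintro ⟨v, t⟩ h
    rw [hΨ] at h
    have ht : t = 0 := by
      have := congrArg (metric (φ p) N) h
      simpa [hnormal, hunit] using this
    subst ht
    simp only [zero_smul, add_zero] at h
    simp [himm (h.trans (map_zero _).symm)]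
  have hsurj : Function.Surjective Ψ :=
    (LinearMap.injective_iff_surjective_of_finrank_eq_finrank
      (by simp [finrank_tangentSpace])).1 hinj
  obtain ⟨⟨v, t⟩, rfl⟩ := hsurj W
  apply eq_zero_of_metric_self_eq_zero (p := φ p)
  conv_lhs => rw [hΨ v t, ← hΨ v t]
  nth_rewrite 2 [hΨ]
  rw [map_add, map_smul, hT, metric_comm, hN]
  simp

theorem differential_tangentPart {W : Sol3} (hN : metric (φ p) N W = 0) :
    differential φ p (tangentPart φ p W) = W := by
  symm
  rw [← sub_eq_zero]
  refine eq_zero_of_orthogonal himm hunit hnormal (by simp [hN, hnormal]) fun v => ?_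
  have := inducedMetric_tangentPart himm W v
  rw [inducedMetric_apply] at this
  simp [this]

theorem differential_tangentPart_eq_sub (W : Sol3) :
    differential φ p (tangentPart φ p W) = W - metric (φ p) N W • N := by
  have h := differential_tangentPart himm hunit hnormal (W := W - metric (φ p) N W • N)
    (by simp [hunit])
  rwa [map_sub, map_smul, tangentPart_normal himm hnormal, smul_zero, sub_zero] at h

end Immersion

/-- The tangent part of E_k is invisible to ξ, so the normal projection in `angle` can be dropped.
-/
theorem angle_eq_toFrame {φ ξ : M → Sol3} (hξ : IsUnitNormal φ ξ) (k : Fin 3) (p : M) :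
    angle φ ξ k p = toFrame (φ p) (ξ p) k := by
  rw [angle, normalPart, map_sub, hξ.normal, sub_zero, metric_eq_dotProduct, toFrame_E]
  simp

end SolSurface

/-! ### Orthonormal triples, curvature and the algebra of Δν₃ -/

namespace Sol3

/-- The vectors `u`, `v`, `n` are an orthonormal basis of `ℝ³`. -/
structure IsOrthonormalFrame (u v n : Sol3) : Prop where
  uu : u ⬝ᵥ u = 1
  vv : v ⬝ᵥ v = 1
  nn : n ⬝ᵥ n = 1
  uv : u ⬝ᵥ v = 0
  nu : n ⬝ᵥ u = 0
  nv : n ⬝ᵥ v = 0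

namespace IsOrthonormalFrame

variable {u v n : Sol3} (h : IsOrthonormalFrame u v n)
include h

/-- The columns of the matrix with rows `u`, `v`, `n` are orthonormal. -/
theorem sum_mul (k l : Fin 3) :
    u k * u l + v k * v l + n k * n l = if k = l then 1 else 0 := by
  have h1 : (Matrix.of ![u, v, n]) * (Matrix.of ![u, v, n]).transpose = 1 := by
    obtain ⟨huu, hvv, hnn, huv, hnu, hnv⟩ := h
    simp only [dotProduct, Fin.sum_univ_three] at huu hvv hnn huv hnu hnv
    ext i j
    fin_cases i <;> fin_cases j <;> simp [Matrix.mul_apply, Fin.sum_univ_three] <;> linarith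
  have h2 := congrFun (congrFun ((mul_eq_one_comm (M := Matrix (Fin 3) (Fin 3) ℝ)).1 h1) k) l
  simpa [Matrix.mul_apply, Fin.sum_univ_three, Matrix.one_apply] using h2

theorem apply_eq (w : Sol3) (k : Fin 3) :
    w k = (w ⬝ᵥ u) * u k + (w ⬝ᵥ v) * v k + (w ⬝ᵥ n) * n k := by
  have h0 := h.sum_mul 0 k
  have h1 := h.sum_mul 1 k
  have h2 := h.sum_mul 2 k
  have hw : w k = w 0 * (if 0 = k then 1 else 0) + w 1 * (if 1 = k then 1 else 0)
      + w 2 * (if 2 = k then 1 else 0) := by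
    fin_cases k <;> simp
  rw [hw, ← h0, ← h1, ← h2]
  simp only [dotProduct, Fin.sum_univ_three]
  ring

theorem dotProduct_eq (w w' : Sol3) :
    w ⬝ᵥ w' = (w ⬝ᵥ u) * (w' ⬝ᵥ u) + (w ⬝ᵥ v) * (w' ⬝ᵥ v) + (w ⬝ᵥ n) * (w' ⬝ᵥ n) := by
  conv_lhs => rw [dotProduct, Fin.sum_univ_three, h.apply_eq w 0, h.apply_eq w 1, h.apply_eq w 2]
  simp only [dotProduct, Fin.sum_univ_three]
  ring

theorem swap : IsOrthonormalFrame v u n :=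
  ⟨h.vv, h.uu, h.nn, by rw [dotProduct_comm, h.uv], h.nv, h.nu⟩

end IsOrthonormalFrame

/-- The curvature of `Sol₃`: the components of `R(u, v) w` in the orthonormal frame `E`. -/
def frameCurvature (u v w : Sol3) : Sol3 :=
  frameConnection u (frameConnection v w) - frameConnection v (frameConnection u w)
    - frameConnection (frameConnection u v - frameConnection v u) w

theorem frameCurvature_swap (u v w : Sol3) : frameCurvature v u w = -frameCurvature u v w := by
  ext k
  fin_cases k <;> simp [frameCurvature, frameConnection] <;> ring

/-- Metric compatibility: in an orthonormal frame the connection coefficients are skew. -/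
theorem frameConnection_dotProduct (a u w : Sol3) :
    frameConnection a u ⬝ᵥ w + u ⬝ᵥ frameConnection a w = 0 := by
  simp [frameConnection, dotProduct, Fin.sum_univ_three]
  ring

/-- The left side is -Ric(u, n), because the triple is orthonormal, and the Ricci tensor of Sol₃ is
-2 dz². -/
theorem IsOrthonormalFrame.frameCurvature_dotProduct {u v n : Sol3}
    (h : IsOrthonormalFrame u v n) :
    frameCurvature u v n ⬝ᵥ v = 2 * n 2 * u 2 := by
  have huv := h.uv
  have hvv := h.vv
  have hnu := h.nu
  have hnv := h.nv
  simp only [dotProduct, Fin.sum_univ_three] at huv hvv hnu hnv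
  -- Third components of u × v = εn and v × n = εu with the same sign ε; the orientation drops out
  -- of the product.
  have key : (u 0 * v 1 - u 1 * v 0) * (v 0 * n 1 - v 1 * n 0) = u 2 * n 2 := by
    linear_combination (v 0 * n 0 + v 1 * n 1) * huv - (u 0 * n 0 + u 1 * n 1) * hvv
      - u 2 * v 2 * hnv + (v 2 * v 2 - 1) * hnu
  simp [frameCurvature, frameConnection, dotProduct, Fin.sum_univ_three]
  linear_combination 2 * key + (v 0 * v 0 + v 1 * v 1 + v 2 * v 2) * hnu
    - (n 0 * v 0 + n 1 * v 1 + n 2 * v 2) * huv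

/-- The pointwise algebra behind the Laplacian of the angle function `ν₃`. -/
theorem angle_laplacian_algebra {a₀ a₁ n α₀ α₁ κ₀₀ κ₀₁ κ₁₁ d₀₀ d₀₁ d₁₀ d₁₁ : Sol3}
    {f F₀ F₁ p₀ p₁ q₀ q₁ : ℝ} (h : IsOrthonormalFrame a₀ a₁ n)
    (hα₀ : α₀ ⬝ᵥ n = 0) (hα₁ : α₁ ⬝ᵥ n = 0)
    (h₀₀ : α₀ ⬝ᵥ a₀ = κ₀₀ ⬝ᵥ n) (h₀₁ : α₀ ⬝ᵥ a₁ = κ₀₁ ⬝ᵥ n)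
    (h₁₀ : α₁ ⬝ᵥ a₀ = κ₀₁ ⬝ᵥ n) (h₁₁ : α₁ ⬝ᵥ a₁ = κ₁₁ ⬝ᵥ n)
    (hd₀ : d₀₀ ⬝ᵥ n = α₀ ⬝ᵥ α₀) (hd₁ : d₁₁ ⬝ᵥ n = α₁ ⬝ᵥ α₁)
    (hs₀ : d₀₀ ⬝ᵥ a₁ + α₀ ⬝ᵥ κ₀₁ = d₀₁ ⬝ᵥ a₀ + α₁ ⬝ᵥ κ₀₀)
    (hs₁ : d₁₀ ⬝ᵥ a₁ + α₀ ⬝ᵥ κ₁₁ = d₁₁ ⬝ᵥ a₀ + α₁ ⬝ᵥ κ₀₁)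
    (hc : d₀₁ - d₁₀ = -frameCurvature a₀ a₁ n)
    (hf : 2 * f = α₀ ⬝ᵥ a₀ + α₁ ⬝ᵥ a₁)
    (hF₀ : 2 * F₀ + 4 * f * (κ₀₀ ⬝ᵥ a₀ + κ₀₁ ⬝ᵥ a₁) =
      2 * (κ₀₁ ⬝ᵥ a₁) * (α₀ ⬝ᵥ a₀) + 2 * (κ₀₀ ⬝ᵥ a₀) * (α₁ ⬝ᵥ a₁)
        - (κ₀₀ ⬝ᵥ a₁ + κ₀₁ ⬝ᵥ a₀) * (α₀ ⬝ᵥ a₁ + α₁ ⬝ᵥ a₀)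
        + (d₀₀ ⬝ᵥ a₀ + α₀ ⬝ᵥ κ₀₀) + (d₀₁ ⬝ᵥ a₁ + α₁ ⬝ᵥ κ₀₁))
    (hF₁ : 2 * F₁ + 4 * f * (κ₀₁ ⬝ᵥ a₀ + κ₁₁ ⬝ᵥ a₁) =
      2 * (κ₁₁ ⬝ᵥ a₁) * (α₀ ⬝ᵥ a₀) + 2 * (κ₀₁ ⬝ᵥ a₀) * (α₁ ⬝ᵥ a₁)
        - (κ₀₁ ⬝ᵥ a₁ + κ₁₁ ⬝ᵥ a₀) * (α₀ ⬝ᵥ a₁ + α₁ ⬝ᵥ a₀)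
        + (d₁₀ ⬝ᵥ a₀ + α₀ ⬝ᵥ κ₀₁) + (d₁₁ ⬝ᵥ a₁ + α₁ ⬝ᵥ κ₁₁))
    (hp₀ : p₀ = -α₀ 2 + a₀ 0 * n 0 - a₀ 1 * n 1) (hp₁ : p₁ = -α₁ 2 + a₁ 0 * n 0 - a₁ 1 * n 1)
    (hq₀ : q₀ = -(d₀₀ 2 - frameConnection a₀ α₀ 2)
      + (κ₀₀ 0 - frameConnection a₀ a₀ 0) * n 0 + a₀ 0 * (-α₀ 0 - frameConnection a₀ n 0)
      - (κ₀₀ 1 - frameConnection a₀ a₀ 1) * n 1 - a₀ 1 * (-α₀ 1 - frameConnection a₀ n 1))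
    (hq₁ : q₁ = -(d₁₁ 2 - frameConnection a₁ α₁ 2)
      + (κ₁₁ 0 - frameConnection a₁ a₁ 0) * n 0 + a₁ 0 * (-α₁ 0 - frameConnection a₁ n 0)
      - (κ₁₁ 1 - frameConnection a₁ a₁ 1) * n 1 - a₁ 1 * (-α₁ 1 - frameConnection a₁ n 1)) :
    (q₀ - p₀ * (κ₀₀ ⬝ᵥ a₀) - p₁ * (κ₀₀ ⬝ᵥ a₁)) + (q₁ - p₀ * (κ₁₁ ⬝ᵥ a₀) - p₁ * (κ₁₁ ⬝ᵥ a₁)) =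
      -2 * (F₀ * a₀ 2 + F₁ * a₁ 2) - n 2 * (2 + (α₀ ⬝ᵥ α₀ + α₁ ⬝ᵥ α₁))
        + 2 * f * (n 0 ^ 2 - n 1 ^ 2)
        - 2 * (a₀ 0 * α₀ 0 + a₁ 0 * α₁ 0) + 2 * (a₀ 1 * α₀ 1 + a₁ 1 * α₁ 1) := by
  -- Dictionary: αᵢ = A aᵢ, κᵢⱼ = ∇̄ᵢaⱼ, dᵢⱼ = ∇̄ᵢαⱼ, Fᵢ = ∂ᵢf, pᵢ = ∂ᵢν₃, qᵢ = ∂ᵢ∂ᵢν₃.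
  -- Torsion-freeness is built in through κ₀₁ = κ₁₀.
  have hc₀ : d₀₁ ⬝ᵥ a₀ - d₁₀ ⬝ᵥ a₀ = 2 * n 2 * a₁ 2 := by
    rw [← sub_dotProduct, hc, ← frameCurvature_swap, h.swap.frameCurvature_dotProduct]
  have hc₁ : d₀₁ ⬝ᵥ a₁ - d₁₀ ⬝ᵥ a₁ = -(2 * n 2 * a₀ 2) := by
    rw [← sub_dotProduct, hc, neg_dotProduct, h.frameCurvature_dotProduct]
  have e₀ := h.apply_eq d₀₀ 2
  have e₁ := h.apply_eq d₁₁ 2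
  have eα₀ := h.apply_eq α₀ 2
  have eα₁ := h.apply_eq α₁ 2
  have eκ₀₀ := h.apply_eq κ₀₀ 0
  have eκ₀₁ := h.apply_eq κ₀₀ 1
  have eκ₁₀ := h.apply_eq κ₁₁ 0
  have eκ₁₁ := h.apply_eq κ₁₁ 1
  have s₀₀ := h.dotProduct_eq α₀ κ₀₀
  have s₀₁ := h.dotProduct_eq α₀ κ₀₁
  have s₀₂ := h.dotProduct_eq α₀ κ₁₁
  have s₁₀ := h.dotProduct_eq α₁ κ₀₀
  have s₁₁ := h.dotProduct_eq α₁ κ₀₁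
  have s₁₂ := h.dotProduct_eq α₁ κ₁₁
  have c00 := h.sum_mul 0 0
  have c11 := h.sum_mul 1 1
  have c22 := h.sum_mul 2 2
  have c02 := h.sum_mul 0 2
  have c12 := h.sum_mul 1 2
  have hnn := h.nn
  simp only [dotProduct, Fin.sum_univ_three] at hnn
  simp [frameConnection] at *
  rw [hα₀] at eα₀ s₀₀ s₀₁ s₀₂
  rw [hα₁] at eα₁ s₁₀ s₁₁ s₁₂
  rw [s₀₀, s₁₁] at hF₀
  rw [s₀₁, s₁₂] at hF₁
  rw [s₀₁, s₁₀] at hs₀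
  rw [s₀₂, s₁₁] at hs₁
  rw [hd₀] at e₀
  rw [hd₁] at e₁
  rw [h₀₁, h₁₀] at *
  rw [← h₀₀] at *
  rw [← h₁₁] at *
  subst hq₀ hq₁ hp₀ hp₁
  rw [e₀, e₁, eκ₀₀, eκ₀₁, eκ₁₀, eκ₁₁, eα₀, eα₁]
  -- This is div A = 2 grad f + curvature, paired with T₃: `hs₁` trades d₁₁·a₀ for d₁₀·a₁, `hc₁`
  -- trades that for d₀₁·a₁, and `hF₀` recognises d₀₀·a₀ + d₀₁·a₁ in 2F₀; the a₁ coefficient is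
  -- symmetric.
  linear_combination a₀ 2 * (hs₁ + hc₁ + hF₀) + a₁ 2 * (hF₁ - hs₀ - hc₀)
    - 2 * (a₀ 2 * (κ₀₀ ⬝ᵥ a₀ + κ₀₁ ⬝ᵥ a₁) + a₁ 2 * (κ₀₁ ⬝ᵥ a₀ + κ₁₁ ⬝ᵥ a₁)) * hf
    - (n 0 ^ 2 - n 1 ^ 2) * hf
    - n 0 * c02 - n 2 * c00 - n 1 * c12 - n 2 * c11 - 2 * n 2 * c22 + 2 * n 2 * hnn

/-! ### Covariant differentiation in frame components -/

open Filter Topology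

variable {E : Type*} [NormedAddCommGroup E] [NormedSpace ℝ E]

theorem fderiv_component {w : E → Sol3} {y : E} (hw : DifferentiableAt ℝ w y) (b : E)
    (k : Fin 3) : fderiv ℝ (fun x => w x k) y b = fderiv ℝ w y b k := by
  rw [fderiv_pi (fun i => differentiableAt_pi.1 hw i)]
  rfl

theorem fderiv_dotProduct {u w : E → Sol3} {y : E} (hu : DifferentiableAt ℝ u y)
    (hw : DifferentiableAt ℝ w y) (b : E) :
    fderiv ℝ (fun x => u x ⬝ᵥ w x) y b = fderiv ℝ u y b ⬝ᵥ w y + u y ⬝ᵥ fderiv ℝ w y b := by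
  have hu' := differentiableAt_pi.1 hu
  have hw' := differentiableAt_pi.1 hw
  have h : (fun x => u x ⬝ᵥ w x) = fun x => u x 0 * w x 0 + u x 1 * w x 1 + u x 2 * w x 2 := by
    funext x; simp [dotProduct, Fin.sum_univ_three]
  rw [h, fderiv_fun_add (by fun_prop) (by fun_prop), fderiv_fun_add (by fun_prop) (by fun_prop),
    fderiv_fun_mul (hu' 0) (hw' 0), fderiv_fun_mul (hu' 1) (hw' 1), fderiv_fun_mul (hu' 2) (hw' 2)]
  simp [fderiv_component hu, fderiv_component hw, dotProduct, Fin.sum_univ_three]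
  ring

theorem DifferentiableAt.dotProduct {u w : E → Sol3} {y : E} (hu : DifferentiableAt ℝ u y)
    (hw : DifferentiableAt ℝ w y) : DifferentiableAt ℝ (fun x => u x ⬝ᵥ w x) y := by
  have hu' := differentiableAt_pi.1 hu
  have hw' := differentiableAt_pi.1 hw
  simp only [_root_.dotProduct, Fin.sum_univ_three]
  fun_prop

theorem ContDiffAt.frameConnection {u w : E → Sol3} {y : E} {m : ℕ∞ω} (hu : ContDiffAt ℝ m u y)
    (hw : ContDiffAt ℝ m w y) : ContDiffAt ℝ m (fun x => frameConnection (u x) (w x)) y := by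
  have hu' := contDiffAt_pi.1 hu
  have hw' := contDiffAt_pi.1 hw
  rw [contDiffAt_pi]
  intro k
  fin_cases k
  · simpa [Sol3.frameConnection] using (hu' 0).mul (hw' 2)
  · simpa [Sol3.frameConnection] using ((hu' 1).mul (hw' 2)).neg
  · simpa [Sol3.frameConnection] using ((hu' 0).mul (hw' 0)).neg.add ((hu' 1).mul (hw' 1))

theorem fderiv_frameConnection {u w : E → Sol3} {y : E} (hu : DifferentiableAt ℝ u y)
    (hw : DifferentiableAt ℝ w y) (b : E) :
    fderiv ℝ (fun x => frameConnection (u x) (w x)) y b =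
      frameConnection (fderiv ℝ u y b) (w y) + frameConnection (u y) (fderiv ℝ w y b) := by
  have hu' := differentiableAt_pi.1 hu
  have hw' := differentiableAt_pi.1 hw
  have hd : DifferentiableAt ℝ (fun x => frameConnection (u x) (w x)) y := by
    rw [differentiableAt_pi]
    intro k
    fin_cases k <;> simp [Sol3.frameConnection] <;> fun_prop
  ext k
  rw [← fderiv_component hd]
  fin_cases k
  · simp only [frameConnection, Fin.zero_eta, Matrix.cons_val_zero, Pi.add_apply]
    rw [fderiv_fun_mul (hu' 0) (hw' 2)]
    simp [fderiv_component hu, fderiv_component hw]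
    ring
  · simp only [frameConnection, Fin.mk_one, Matrix.cons_val_one, Matrix.cons_val_zero, Pi.add_apply]
    rw [fderiv_fun_neg, fderiv_fun_mul (hu' 1) (hw' 2)]
    simp [fderiv_component hu, fderiv_component hw]
    ring
  · simp only [frameConnection, Fin.reduceFinMk, Matrix.cons_val, Pi.add_apply]
    rw [fderiv_fun_add (by fun_prop) (by fun_prop), fderiv_fun_neg,
      fderiv_fun_mul (hu' 0) (hw' 0), fderiv_fun_mul (hu' 1) (hw' 1)]
    simp [fderiv_component hu, fderiv_component hw]
    ring

/-- The covariant derivative in direction `b`, in the frame `E`, of a vector field along a map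
into `Sol₃` whose derivative in direction `b` has components `a`. -/
def framedDeriv (a : E → Sol3) (b : E) (w : E → Sol3) (y : E) : Sol3 :=
  fderiv ℝ w y b + frameConnection (a y) (w y)

theorem framedDeriv_apply (a : E → Sol3) (b : E) (w : E → Sol3) (y : E) :
    framedDeriv a b w y = fderiv ℝ w y b + frameConnection (a y) (w y) := rfl

theorem fderiv_eq_framedDeriv_sub (a : E → Sol3) (b : E) (w : E → Sol3) (y : E) :
    fderiv ℝ w y b = framedDeriv a b w y - frameConnection (a y) (w y) := by
  simp [framedDeriv]

theorem ContDiffAt.fderiv_const_apply {F : Type*} [NormedAddCommGroup F] [NormedSpace ℝ F]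
    {w : E → F} {y : E} (hw : ContDiffAt ℝ ∞ w y) (b : E) :
    ContDiffAt ℝ ∞ (fun x => fderiv ℝ w x b) y :=
  (hw.fderiv_right (m := ∞) (by simp)).clm_apply contDiffAt_const

theorem ContDiffAt.framedDeriv {a w : E → Sol3} {y : E} (ha : ContDiffAt ℝ ∞ a y)
    (hw : ContDiffAt ℝ ∞ w y) (b : E) : ContDiffAt ℝ ∞ (framedDeriv a b w) y :=
  (ContDiffAt.fderiv_const_apply hw b).add (ContDiffAt.frameConnection ha hw)

theorem ContDiffAt.eventually_differentiableAt {F : Type*} [NormedAddCommGroup F]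
    [NormedSpace ℝ F] {w : E → F} {y : E} (hw : ContDiffAt ℝ ∞ w y) :
    ∀ᶠ x in 𝓝 y, DifferentiableAt ℝ w x :=
  ((hw.of_le (m := 1) (by simp)).eventually (by simp)).mono fun _ h => h.differentiableAt (by simp)

theorem fderiv_dotProduct_eq_framedDeriv (a : E → Sol3) {u w : E → Sol3} {y : E}
    (hu : DifferentiableAt ℝ u y) (hw : DifferentiableAt ℝ w y) (b : E) :
    fderiv ℝ (fun x => u x ⬝ᵥ w x) y b =
      framedDeriv a b u y ⬝ᵥ w y + u y ⬝ᵥ framedDeriv a b w y := by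
  have h := frameConnection_dotProduct (a y) (u y) (w y)
  rw [fderiv_dotProduct hu hw, framedDeriv, framedDeriv, add_dotProduct, dotProduct_add]
  linarith

theorem frameConnection_sub_left (u v w : Sol3) :
    frameConnection (u - v) w = frameConnection u w - frameConnection v w := by
  ext k
  fin_cases k <;> simp [frameConnection] <;> ring

theorem frameConnection_add_right (u v w : Sol3) :
    frameConnection u (v + w) = frameConnection u v + frameConnection u w := by
  ext k
  fin_cases k <;> simp [frameConnection] <;> ring

theorem framedDeriv_neg (a : E → Sol3) (b : E) (w : E → Sol3) (y : E) :
    framedDeriv a b (fun x => -w x) y = -framedDeriv a b w y := by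
  have h : frameConnection (a y) (-w y) = -frameConnection (a y) (w y) := by
    ext k
    fin_cases k <;> simp [frameConnection]; ring
  simp only [framedDeriv]
  rw [fderiv_fun_neg, h]
  simp
  abel

/-- Second partial derivatives commute, so only connection terms survive. The torsion hypothesis
converts ∂₁a₀ - ∂₀a₁ into the bracket term of `frameCurvature`. -/
theorem framedDeriv_comm {a₀ a₁ w : E → Sol3} {y b₀ b₁ : E} (ha₀ : DifferentiableAt ℝ a₀ y)
    (ha₁ : DifferentiableAt ℝ a₁ y) (hw : ContDiffAt ℝ ∞ w y)
    (htorsion : framedDeriv a₀ b₀ a₁ y = framedDeriv a₁ b₁ a₀ y) :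
    framedDeriv a₀ b₀ (framedDeriv a₁ b₁ w) y - framedDeriv a₁ b₁ (framedDeriv a₀ b₀ w) y =
      frameCurvature (a₀ y) (a₁ y) (w y) := by
  have hsymm : IsSymmSndFDerivAt ℝ w y := hw.isSymmSndFDerivAt (by
    rw [minSmoothness_of_isRCLikeNormedField]
    exact WithTop.coe_le_coe.2 le_top)
  have hd : DifferentiableAt ℝ w y := hw.differentiableAt (by simp)
  have hdd : DifferentiableAt ℝ (fderiv ℝ w) y :=
    (hw.fderiv_right (m := ∞) (by simp)).differentiableAt (by simp)
  have hc : ∀ {a : E → Sol3}, DifferentiableAt ℝ a y →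
      DifferentiableAt ℝ (fun x => frameConnection (a x) (w x)) y := by
    intro a ha
    have ha' := differentiableAt_pi.1 ha
    have hw' := differentiableAt_pi.1 hd
    rw [differentiableAt_pi]
    intro k
    fin_cases k <;> simp [Sol3.frameConnection] <;> fun_prop
  have hsnd : ∀ (b b' : E) {a : E → Sol3}, DifferentiableAt ℝ a y →
      fderiv ℝ (framedDeriv a b w) y b' = fderiv ℝ (fderiv ℝ w) y b' b
        + (frameConnection (fderiv ℝ a y b') (w y) + frameConnection (a y) (fderiv ℝ w y b')) := by
    intro b b' a ha
    unfold framedDeriv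
    rw [fderiv_fun_add (by fun_prop) (hc ha), ← fderiv_frameConnection ha hd,
      fderiv_clm_apply hdd (by fun_prop)]
    simp
  have ht : frameConnection (fderiv ℝ a₀ y b₁ - fderiv ℝ a₁ y b₀) (w y) =
      frameConnection (frameConnection (a₀ y) (a₁ y) - frameConnection (a₁ y) (a₀ y)) (w y) := by
    congr 1
    simp only [framedDeriv] at htorsion
    rw [sub_eq_sub_iff_add_eq_add, ← htorsion, add_comm]
  rw [frameConnection_sub_left] at ht
  have hs := hsymm.eq b₀ b₁
  rw [framedDeriv_apply a₀ b₀ (framedDeriv a₁ b₁ w), framedDeriv_apply a₁ b₁ (framedDeriv a₀ b₀ w),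
    hsnd b₁ b₀ ha₁, hsnd b₀ b₁ ha₀]
  simp only [framedDeriv, frameConnection_add_right, frameCurvature]
  rw [hs, ← ht]
  abel

/-! ### Local surface theory: second fundamental form, Codazzi, mean curvature -/

open Filter Topology

variable {E : Type*} [NormedAddCommGroup E] [NormedSpace ℝ E]

/-- The frame components near `y` of the coordinate vector fields `a i` and of a unit normal `n`
of a surface in `Sol₃`, where `a i` is the derivative of the surface in direction `b i`. -/
structure FramedSurface (a : Fin 2 → E → Sol3) (b : Fin 2 → E) (n : E → Sol3) (y : E) : Prop where
  contDiffAt_tangent : ∀ i, ContDiffAt ℝ ∞ (a i) y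
  contDiffAt_normal : ContDiffAt ℝ ∞ n y
  unit : ∀ᶠ x in 𝓝 y, n x ⬝ᵥ n x = 1
  normal : ∀ᶠ x in 𝓝 y, ∀ i, n x ⬝ᵥ a i x = 0
  torsion : ∀ᶠ x in 𝓝 y, ∀ i j, framedDeriv (a i) (b i) (a j) x = framedDeriv (a j) (b j) (a i) x

/-- The frame components of `-∇̄_i n`, the image of `a i` under the shape operator. -/
def framedShape (a : Fin 2 → E → Sol3) (b : Fin 2 → E) (n : E → Sol3) (i : Fin 2) (x : E) : Sol3 :=
  -framedDeriv (a i) (b i) n x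

namespace FramedSurface

variable {a : Fin 2 → E → Sol3} {b : Fin 2 → E} {n : E → Sol3} {y : E}
  (h : FramedSurface a b n y)
include h

theorem contDiffAt_shape (i : Fin 2) : ContDiffAt ℝ ∞ (framedShape a b n i) y :=
  (ContDiffAt.framedDeriv (h.contDiffAt_tangent i) h.contDiffAt_normal (b i)).neg

theorem differentiableAt_tangent (i : Fin 2) : DifferentiableAt ℝ (a i) y :=
  (h.contDiffAt_tangent i).differentiableAt (by simp)

theorem differentiableAt_normal : DifferentiableAt ℝ n y :=
  h.contDiffAt_normal.differentiableAt (by simp)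

theorem differentiableAt_shape (i : Fin 2) : DifferentiableAt ℝ (framedShape a b n i) y :=
  (h.contDiffAt_shape i).differentiableAt (by simp)

/-- This and the next identities come from differentiating n·n = 1, n·aⱼ = 0 and their consequences.
They are stated on a neighbourhood where they are to be differentiated again. -/
theorem eventually_shape_dotProduct_normal :
    ∀ᶠ x in 𝓝 y, ∀ i, framedShape a b n i x ⬝ᵥ n x = 0 := by
  filter_upwards [eventually_eventually_nhds.2 h.unit,
    ContDiffAt.eventually_differentiableAt h.contDiffAt_normal] with x hx hn i
  have h1 : fderiv ℝ (fun z => n z ⬝ᵥ n z) x (b i) = 0 := by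
    have : (fun z => n z ⬝ᵥ n z) =ᶠ[𝓝 x] fun _ => (1 : ℝ) := hx
    rw [this.fderiv_eq]; simp
  rw [fderiv_dotProduct_eq_framedDeriv (a i) hn hn, dotProduct_comm (n x)] at h1
  rw [framedShape, neg_dotProduct]
  linarith

theorem eventually_shape_dotProduct_tangent :
    ∀ᶠ x in 𝓝 y, ∀ i j,
      framedShape a b n i x ⬝ᵥ a j x = framedDeriv (a i) (b i) (a j) x ⬝ᵥ n x := by
  filter_upwards [eventually_eventually_nhds.2 h.normal,
    ContDiffAt.eventually_differentiableAt h.contDiffAt_normal,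
    eventually_all.2 fun i => ContDiffAt.eventually_differentiableAt (h.contDiffAt_tangent i)]
    with x hx hn ha i j
  have h1 : fderiv ℝ (fun z => n z ⬝ᵥ a j z) x (b i) = 0 := by
    have : (fun z => n z ⬝ᵥ a j z) =ᶠ[𝓝 x] fun _ => (0 : ℝ) := hx.mono fun z hz => hz j
    rw [this.fderiv_eq]; simp
  rw [fderiv_dotProduct_eq_framedDeriv (a i) hn (ha j), dotProduct_comm (n x)] at h1
  rw [framedShape, neg_dotProduct]
  linarith

theorem eventually_shape_symm :
    ∀ᶠ x in 𝓝 y, ∀ i j, framedShape a b n i x ⬝ᵥ a j x = framedShape a b n j x ⬝ᵥ a i x := by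
  filter_upwards [h.eventually_shape_dotProduct_tangent, h.torsion] with x hx ht i j
  rw [hx, hx, ht]

theorem framedDeriv_shape_dotProduct_normal (k i : Fin 2) :
    framedDeriv (a k) (b k) (framedShape a b n i) y ⬝ᵥ n y =
      framedShape a b n k y ⬝ᵥ framedShape a b n i y := by
  have h1 : fderiv ℝ (fun z => framedShape a b n i z ⬝ᵥ n z) y (b k) = 0 := by
    have : (fun z => framedShape a b n i z ⬝ᵥ n z) =ᶠ[𝓝 y] fun _ => (0 : ℝ) :=
      h.eventually_shape_dotProduct_normal.mono fun z hz => hz i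
    rw [this.fderiv_eq]; simp
  rw [fderiv_dotProduct_eq_framedDeriv (a k) (h.differentiableAt_shape i)
    h.differentiableAt_normal] at h1
  rw [dotProduct_comm (framedShape a b n k y)]
  simp only [framedShape, dotProduct_neg] at h1 ⊢
  linarith

theorem fderiv_shape_symm (k i j : Fin 2) :
    framedDeriv (a k) (b k) (framedShape a b n i) y ⬝ᵥ a j y
        + framedShape a b n i y ⬝ᵥ framedDeriv (a k) (b k) (a j) y =
      framedDeriv (a k) (b k) (framedShape a b n j) y ⬝ᵥ a i y
        + framedShape a b n j y ⬝ᵥ framedDeriv (a k) (b k) (a i) y := by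
  have h1 : (fun z => framedShape a b n i z ⬝ᵥ a j z) =ᶠ[𝓝 y]
      fun z => framedShape a b n j z ⬝ᵥ a i z :=
    h.eventually_shape_symm.mono fun z hz => hz i j
  have h2 := congrArg (fun L : E →L[ℝ] ℝ => L (b k)) h1.fderiv_eq
  simpa only [fderiv_dotProduct_eq_framedDeriv (a k) (h.differentiableAt_shape _)
    (h.differentiableAt_tangent _)] using h2

/-- As αᵢ = -∇̄ᵢn, this is the commutator of covariant derivatives applied to n. -/
theorem codazzi :
    framedDeriv (a 0) (b 0) (framedShape a b n 1) y
        - framedDeriv (a 1) (b 1) (framedShape a b n 0) y =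
      -frameCurvature (a 0 y) (a 1 y) (n y) := by
  have h1 := framedDeriv_comm (h.differentiableAt_tangent 0) (h.differentiableAt_tangent 1)
    h.contDiffAt_normal (h.torsion.self_of_nhds 0 1)
  have h2 : ∀ i, framedShape a b n i = fun x => -framedDeriv (a i) (b i) n x := fun i => rfl
  rw [← h1, h2, h2, framedDeriv_neg, framedDeriv_neg]
  abel

/-- Here ν₃ = ⟨n, E₃⟩; the term with A comes from ∇̄n, the others from ∇̄_v E₃ = v¹E₁ - v²E₂. -/
theorem eventually_fderiv_angle :
    ∀ᶠ x in 𝓝 y, ∀ i, fderiv ℝ (fun z => n z 2) x (b i) =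
      -framedShape a b n i x 2 + a i x 0 * n x 0 - a i x 1 * n x 1 := by
  filter_upwards [ContDiffAt.eventually_differentiableAt h.contDiffAt_normal] with x hn i
  rw [fderiv_component hn, fderiv_eq_framedDeriv_sub (a i)]
  simp [framedShape, frameConnection]
  ring

theorem fderiv_fderiv_angle (i : Fin 2) :
    fderiv ℝ (fun x => fderiv ℝ (fun z => n z 2) x (b i)) y (b i) =
      -(framedDeriv (a i) (b i) (framedShape a b n i) y 2
          - frameConnection (a i y) (framedShape a b n i y) 2)
        + (framedDeriv (a i) (b i) (a i) y 0 - frameConnection (a i y) (a i y) 0) * n y 0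
        + a i y 0 * (-framedShape a b n i y 0 - frameConnection (a i y) (n y) 0)
        - (framedDeriv (a i) (b i) (a i) y 1 - frameConnection (a i y) (a i y) 1) * n y 1
        - a i y 1 * (-framedShape a b n i y 1 - frameConnection (a i y) (n y) 1) := by
  have h1 : (fun x => fderiv ℝ (fun z => n z 2) x (b i)) =ᶠ[𝓝 y]
      fun x => -framedShape a b n i x 2 + a i x 0 * n x 0 - a i x 1 * n x 1 :=
    h.eventually_fderiv_angle.mono fun x hx => hx i
  have hs := differentiableAt_pi.1 (h.differentiableAt_shape i)
  have ha := differentiableAt_pi.1 (h.differentiableAt_tangent i)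
  have hn := differentiableAt_pi.1 h.differentiableAt_normal
  rw [h1.fderiv_eq, fderiv_fun_sub (by fun_prop) (by fun_prop),
    fderiv_fun_add (by fun_prop) (by fun_prop), fderiv_fun_neg, fderiv_fun_mul (ha 0) (hn 0),
    fderiv_fun_mul (ha 1) (hn 1)]
  simp only [_root_.sub_apply, _root_.add_apply,
    _root_.neg_apply, _root_.smul_apply, smul_eq_mul,
    fderiv_component (h.differentiableAt_shape i), fderiv_component (h.differentiableAt_tangent i),
    fderiv_component h.differentiableAt_normal, fderiv_eq_framedDeriv_sub (a i)]
  simp only [framedShape, Pi.sub_apply, Pi.neg_apply]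
  ring

/-- The trace formula `2 f det g = g₁₁ h₀₀ - g₀₁ (h₀₁ + h₁₀) + g₀₀ h₁₁` for the mean curvature `f`
near `y`. -/
def IsMeanCurvature (_ : FramedSurface a b n y) (f : E → ℝ) : Prop :=
  ∀ᶠ x in 𝓝 y, 2 * f x * ((a 0 x ⬝ᵥ a 0 x) * (a 1 x ⬝ᵥ a 1 x) - (a 0 x ⬝ᵥ a 1 x) ^ 2) =
    (a 1 x ⬝ᵥ a 1 x) * (framedShape a b n 0 x ⬝ᵥ a 0 x)
      - (a 0 x ⬝ᵥ a 1 x) * (framedShape a b n 0 x ⬝ᵥ a 1 x + framedShape a b n 1 x ⬝ᵥ a 0 x)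
      + (a 0 x ⬝ᵥ a 0 x) * (framedShape a b n 1 x ⬝ᵥ a 1 x)

theorem differentiableAt_meanCurvature (hframe : IsOrthonormalFrame (a 0 y) (a 1 y) (n y))
    {f : E → ℝ} (hf : h.IsMeanCurvature f) : DifferentiableAt ℝ f y := by
  have hg : ∀ i j, DifferentiableAt ℝ (fun x => a i x ⬝ᵥ a j x) y := fun i j =>
    DifferentiableAt.dotProduct (h.differentiableAt_tangent i) (h.differentiableAt_tangent j)
  have hh : ∀ i j, DifferentiableAt ℝ (fun x => framedShape a b n i x ⬝ᵥ a j x) y := fun i j =>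
    DifferentiableAt.dotProduct (h.differentiableAt_shape i) (h.differentiableAt_tangent j)
  have hdet : DifferentiableAt ℝ
      (fun x => (a 0 x ⬝ᵥ a 0 x) * (a 1 x ⬝ᵥ a 1 x) - (a 0 x ⬝ᵥ a 1 x) ^ 2) y :=
    ((hg 0 0).mul (hg 1 1)).sub ((hg 0 1).pow 2)
  have hdet1 : (a 0 y ⬝ᵥ a 0 y) * (a 1 y ⬝ᵥ a 1 y) - (a 0 y ⬝ᵥ a 1 y) ^ 2 ≠ 0 := by
    rw [hframe.uu, hframe.vv, hframe.uv]; norm_num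
  have hq := ((((hg 1 1).mul (hh 0 0)).sub ((hg 0 1).mul ((hh 0 1).add (hh 1 0)))).add
    ((hg 0 0).mul (hh 1 1))).mul ((hdet.fun_inv hdet1).const_mul 2⁻¹)
  refine hq.congr_of_eventuallyEq ?_
  filter_upwards [hf, hdet.continuousAt.eventually_ne hdet1] with x hx hx'
  simp only [Pi.add_apply, Pi.sub_apply, Pi.mul_apply]
  rw [← hx]
  field_simp

/-- The cleared trace formula is differentiated before orthonormality is used. At y the Gram matrix
is the identity, so the derivative of its determinant is that of its trace, which is the source of
the factor 4. -/
theorem fderiv_meanCurvature (hframe : IsOrthonormalFrame (a 0 y) (a 1 y) (n y))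
    {f : E → ℝ} (hf : h.IsMeanCurvature f) (k : Fin 2) :
    2 * fderiv ℝ f y (b k) + 4 * f y * (framedDeriv (a k) (b k) (a 0) y ⬝ᵥ a 0 y
        + framedDeriv (a k) (b k) (a 1) y ⬝ᵥ a 1 y) =
      2 * (framedDeriv (a k) (b k) (a 1) y ⬝ᵥ a 1 y) * (framedShape a b n 0 y ⬝ᵥ a 0 y)
      + 2 * (framedDeriv (a k) (b k) (a 0) y ⬝ᵥ a 0 y) * (framedShape a b n 1 y ⬝ᵥ a 1 y)
      - (framedDeriv (a k) (b k) (a 0) y ⬝ᵥ a 1 y + framedDeriv (a k) (b k) (a 1) y ⬝ᵥ a 0 y)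
        * (framedShape a b n 0 y ⬝ᵥ a 1 y + framedShape a b n 1 y ⬝ᵥ a 0 y)
      + (framedDeriv (a k) (b k) (framedShape a b n 0) y ⬝ᵥ a 0 y
        + framedShape a b n 0 y ⬝ᵥ framedDeriv (a k) (b k) (a 0) y)
      + (framedDeriv (a k) (b k) (framedShape a b n 1) y ⬝ᵥ a 1 y
        + framedShape a b n 1 y ⬝ᵥ framedDeriv (a k) (b k) (a 1) y) := by
  have hfd := h.differentiableAt_meanCurvature hframe hf
  have hg : ∀ i j, DifferentiableAt ℝ (fun x => a i x ⬝ᵥ a j x) y := fun i j =>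
    DifferentiableAt.dotProduct (h.differentiableAt_tangent i) (h.differentiableAt_tangent j)
  have hh : ∀ i j, DifferentiableAt ℝ (fun x => framedShape a b n i x ⬝ᵥ a j x) y := fun i j =>
    DifferentiableAt.dotProduct (h.differentiableAt_shape i) (h.differentiableAt_tangent j)
  have hg' : ∀ i j, fderiv ℝ (fun x => a i x ⬝ᵥ a j x) y (b k) = _ := fun i j =>
    fderiv_dotProduct_eq_framedDeriv (a k) (h.differentiableAt_tangent i)
      (h.differentiableAt_tangent j) (b k)
  have hh' : ∀ i j, fderiv ℝ (fun x => framedShape a b n i x ⬝ᵥ a j x) y (b k) = _ := fun i j =>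
    fderiv_dotProduct_eq_framedDeriv (a k) (h.differentiableAt_shape i)
      (h.differentiableAt_tangent j) (b k)
  have hl := ((hfd.hasFDerivAt.const_mul 2).mul
    (((hg 0 0).hasFDerivAt.mul (hg 1 1).hasFDerivAt).sub
      ((hg 0 1).hasFDerivAt.mul (hg 0 1).hasFDerivAt)))
  have hr := (((hg 1 1).hasFDerivAt.mul (hh 0 0).hasFDerivAt).sub ((hg 0 1).hasFDerivAt.mul
    ((hh 0 1).hasFDerivAt.add (hh 1 0).hasFDerivAt))).add
    ((hg 0 0).hasFDerivAt.mul (hh 1 1).hasFDerivAt)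
  have heq := hl.unique (hr.congr_of_eventuallyEq (hf.mono fun x hx => by
    simp only [Pi.add_apply, Pi.sub_apply, Pi.mul_apply]
    rw [← hx]; ring))
  have := congrArg (fun L : E →L[ℝ] ℝ => L (b k)) heq
  have hvu : a 1 y ⬝ᵥ a 0 y = 0 := by rw [dotProduct_comm, hframe.uv]
  simp [hg', hh', hframe.uu, hframe.vv, hframe.uv] at this
  simp only [dotProduct_comm (a _ y) (framedDeriv _ _ _ _)] at this
  linarith

theorem eventuallyEq_grad_angle_sq {G : E → Sol3}
    (hG : ∀ᶠ x in 𝓝 y, ∀ i, G x ⬝ᵥ a i x = fderiv ℝ (fun z => n z 2 ^ 2) x (b i)) (j : Fin 2) :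
    (fun x => G x ⬝ᵥ a j x) =ᶠ[𝓝 y] fun x => 2 * (n x 2 * fderiv ℝ (fun z => n z 2) x (b j)) := by
  have hν : ContDiffAt ℝ ∞ (fun z => n z 2) y := contDiffAt_pi.1 h.contDiffAt_normal 2
  filter_upwards [hG, ContDiffAt.eventually_differentiableAt hν] with x hx hd
  rw [hx, fderiv_fun_pow 2 hd]
  simp
  ring

theorem differentiableAt_angle_mul_fderiv_angle (j : Fin 2) :
    DifferentiableAt ℝ (fun x => n x 2 * fderiv ℝ (fun z => n z 2) x (b j)) y := by
  have hν : ContDiffAt ℝ ∞ (fun z => n z 2) y := contDiffAt_pi.1 h.contDiffAt_normal 2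
  exact (hν.mul (ContDiffAt.fderiv_const_apply hν (b j))).differentiableAt (by simp)

theorem framedDeriv_dotProduct_tangent {G : E → Sol3} (hG : DifferentiableAt ℝ G y) (i : Fin 2) :
    framedDeriv (a i) (b i) G y ⬝ᵥ a i y = fderiv ℝ (fun x => G x ⬝ᵥ a i x) y (b i)
      - G y ⬝ᵥ framedDeriv (a i) (b i) (a i) y := by
  rw [fderiv_dotProduct_eq_framedDeriv (a i) hG (h.differentiableAt_tangent i)]
  ring

end FramedSurface

/-! ### Gradient of ν₃ and the Bochner formula in frame components -/

open Filter Topology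

/-- The squared length of the gradient of the angle function `ν₃`. -/
theorem angle_gradient_algebra {a₀ a₁ n α₀ α₁ : Sol3} {p₀ p₁ : ℝ}
    (h : IsOrthonormalFrame a₀ a₁ n) (hα₀ : α₀ ⬝ᵥ n = 0) (hα₁ : α₁ ⬝ᵥ n = 0)
    (hsymm : α₀ ⬝ᵥ a₁ = α₁ ⬝ᵥ a₀)
    (hp₀ : p₀ = -α₀ 2 + a₀ 0 * n 0 - a₀ 1 * n 1) (hp₁ : p₁ = -α₁ 2 + a₁ 0 * n 0 - a₁ 1 * n 1) :
    p₀ ^ 2 + p₁ ^ 2 =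
      (a₀ 2 • α₀ + a₁ 2 • α₁) ⬝ᵥ (a₀ 2 • α₀ + a₁ 2 • α₁)
        + 2 * n 1 * (a₀ 2 * α₀ 1 + a₁ 2 * α₁ 1) - 2 * n 0 * (a₀ 2 * α₀ 0 + a₁ 2 * α₁ 0)
        + 1 - n 2 ^ 2 - (n 1 ^ 2 - n 0 ^ 2) ^ 2 := by
  have e00 := h.apply_eq α₀ 0
  have e01 := h.apply_eq α₀ 1
  have e02 := h.apply_eq α₀ 2
  have e10 := h.apply_eq α₁ 0
  have e11 := h.apply_eq α₁ 1
  have e12 := h.apply_eq α₁ 2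
  have c00 := h.sum_mul 0 0
  have c11 := h.sum_mul 1 1
  have c01 := h.sum_mul 0 1
  have hnn := h.nn
  simp only [dotProduct, Fin.sum_univ_three] at hnn
  simp only [hα₀, hα₁, hsymm] at e00 e01 e02 e10 e11 e12
  simp at c00 c11 c01
  rw [h.dotProduct_eq (a₀ 2 • α₀ + a₁ 2 • α₁) (a₀ 2 • α₀ + a₁ 2 • α₁)]
  simp only [add_dotProduct, smul_dotProduct, smul_eq_mul, hα₀, hα₁, hsymm]
  rw [hp₀, hp₁, e00, e01, e02, e10, e11, e12]
  -- What remains is |ν₁T₁ - ν₂T₂|² = ν₁² + ν₂² - (ν₁² - ν₂²)², with ν₁² + ν₂² = 1 - ν₃².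
  linear_combination n 0 ^ 2 * c00 + n 1 ^ 2 * c11 - 2 * n 0 * n 1 * c01 + hnn

theorem angle_sq_algebra {a₀ a₁ n α₀ α₁ : Sol3} {f F₀ F₁ p₀ p₁ L x₀ x₁ : ℝ}
    (h : IsOrthonormalFrame a₀ a₁ n) (hα₀ : α₀ ⬝ᵥ n = 0) (hα₁ : α₁ ⬝ᵥ n = 0)
    (hsymm : α₀ ⬝ᵥ a₁ = α₁ ⬝ᵥ a₀) (hf : 2 * f = α₀ ⬝ᵥ a₀ + α₁ ⬝ᵥ a₁)
    (hp₀ : p₀ = -α₀ 2 + a₀ 0 * n 0 - a₀ 1 * n 1) (hp₁ : p₁ = -α₁ 2 + a₁ 0 * n 0 - a₁ 1 * n 1)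
    (hL : L = -2 * (F₀ * a₀ 2 + F₁ * a₁ 2) - n 2 * (2 + (α₀ ⬝ᵥ α₀ + α₁ ⬝ᵥ α₁))
        + 2 * f * (n 0 ^ 2 - n 1 ^ 2)
        - 2 * (a₀ 0 * α₀ 0 + a₁ 0 * α₁ 0) + 2 * (a₀ 1 * α₀ 1 + a₁ 1 * α₁ 1))
    (hx₀ : x₀ = (F₀ * n 2 + f * p₀) * a₀ 2
        + f * n 2 * (a₀ 0 ^ 2 - a₀ 1 ^ 2 + n 2 * (α₀ ⬝ᵥ a₀)))
    (hx₁ : x₁ = (F₁ * n 2 + f * p₁) * a₁ 2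
        + f * n 2 * (a₁ 0 ^ 2 - a₁ 1 ^ 2 + n 2 * (α₁ ⬝ᵥ a₁))) :
    p₀ ^ 2 + p₁ ^ 2 + n 2 * L =
      -(x₀ + x₁) - n 2 * (F₀ * a₀ 2 + F₁ * a₁ 2)
        + 2 * n 2 * (a₀ 1 * α₀ 1 + a₁ 1 * α₁ 1) - 2 * n 2 * (a₀ 0 * α₀ 0 + a₁ 0 * α₁ 0)
        + 2 * n 1 * (a₀ 2 * α₀ 1 + a₁ 2 * α₁ 1) - 2 * n 0 * (a₀ 2 * α₀ 0 + a₁ 2 * α₁ 0)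
        + n 2 ^ 2 * (2 * f ^ 2 - 3 - (α₀ ⬝ᵥ α₀ + α₁ ⬝ᵥ α₁))
        - f * (a₀ 2 * α₀ 2 + a₁ 2 * α₁ 2)
        + (a₀ 2 • α₀ + a₁ 2 • α₁) ⬝ᵥ (a₀ 2 • α₀ + a₁ 2 • α₁)
        + 1 - (n 1 ^ 2 - n 0 ^ 2) ^ 2 := by
  rw [angle_gradient_algebra h hα₀ hα₁ hsymm hp₀ hp₁, hL, hx₀, hx₁, hp₀, hp₁]
  have c00 := h.sum_mul 0 0
  have c11 := h.sum_mul 1 1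
  have c02 := h.sum_mul 0 2
  have c12 := h.sum_mul 1 2
  simp at c00 c11 c02 c12
  linear_combination f * n 2 * (c00 - c11) + f * (n 0 * c02 - n 1 * c12) - f * n 2 ^ 2 * hf

variable {E : Type*} [NormedAddCommGroup E] [NormedSpace ℝ E]

namespace FramedSurface

variable {a : Fin 2 → E → Sol3} {b : Fin 2 → E} {n : E → Sol3} {y : E}
  (h : FramedSurface a b n y) (hframe : IsOrthonormalFrame (a 0 y) (a 1 y) (n y))
include h hframe

/-- A vector field whose products with a smooth frame are differentiable is differentiable. -/
theorem differentiableAt_of_dotProduct {G : E → Sol3}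
    (hG : ∀ i, DifferentiableAt ℝ (fun x => G x ⬝ᵥ a i x) y)
    (hGn : DifferentiableAt ℝ (fun x => G x ⬝ᵥ n x) y) : DifferentiableAt ℝ G y := by
  -- Cramer's rule: `c` is the cross product and `N` the triple product, so G is recovered from its
  -- products with a₀, a₁, n on all points where N ≠ 0.
  let c : (Fin 3 → ℝ) → (Fin 3 → ℝ) → Fin 3 → ℝ := fun u v =>
    ![u 1 * v 2 - u 2 * v 1, u 2 * v 0 - u 0 * v 2, u 0 * v 1 - u 1 * v 0]
  let N : E → ℝ := fun x => a 0 x ⬝ᵥ c (a 1 x) (n x)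
  have ha0 := differentiableAt_pi.1 (h.differentiableAt_tangent 0)
  have ha1 := differentiableAt_pi.1 (h.differentiableAt_tangent 1)
  have hn := differentiableAt_pi.1 h.differentiableAt_normal
  have hNd : DifferentiableAt ℝ N y := by
    simp only [N, c, dotProduct, Fin.sum_univ_three]
    simp only [Matrix.cons_val]
    fun_prop
  have hN : N y ≠ 0 := by
    intro h0
    have hu : N y * N y = 1 := by
      have h1 := hframe.uu
      have h2 := hframe.vv
      have h3 := hframe.nn
      have h4 := hframe.uv
      have h5 := hframe.nu
      have h6 := hframe.nv
      -- The square of the triple product is the Gram determinant.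
      have key : N y * N y = (a 0 y ⬝ᵥ a 0 y) * ((a 1 y ⬝ᵥ a 1 y) * (n y ⬝ᵥ n y) - (n y ⬝ᵥ a 1 y) ^ 2)
          - (a 0 y ⬝ᵥ a 1 y) * ((a 0 y ⬝ᵥ a 1 y) * (n y ⬝ᵥ n y) - (n y ⬝ᵥ a 0 y) * (n y ⬝ᵥ a 1 y))
          + (n y ⬝ᵥ a 0 y) * ((a 0 y ⬝ᵥ a 1 y) * (n y ⬝ᵥ a 1 y) - (n y ⬝ᵥ a 0 y) * (a 1 y ⬝ᵥ a 1 y)) := by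
        simp only [N, c, dotProduct, Fin.sum_univ_three]
        simp only [Matrix.cons_val]
        ring
      rw [key, h1, h2, h3, h4, h5, h6]
      ring
    rw [h0] at hu
    norm_num at hu
  rw [differentiableAt_pi]
  intro k
  have hk : DifferentiableAt ℝ (fun x => (N x)⁻¹ * ((G x ⬝ᵥ a 0 x) * c (a 1 x) (n x) k
      + (G x ⬝ᵥ a 1 x) * c (n x) (a 0 x) k + (G x ⬝ᵥ n x) * c (a 0 x) (a 1 x) k)) y := by
    have h0 := hG 0
    have h1 := hG 1
    have hNi := hNd.fun_inv hN
    fin_cases k <;> simp only [c, Fin.zero_eta, Fin.mk_one, Fin.reduceFinMk, Matrix.cons_val] <;>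
      fun_prop
  refine hk.congr_of_eventuallyEq ?_
  filter_upwards [hNd.continuousAt.eventually_ne hN] with x hx
  rw [eq_inv_mul_iff_mul_eq₀ hx]
  simp only [N, c, dotProduct, Fin.sum_univ_three]
  fin_cases k <;> simp only [Fin.zero_eta, Fin.mk_one, Fin.reduceFinMk, Matrix.cons_val] <;> ring

/-- The gradient is known only through its inner products. Its differentiability must be proved,
since the divergence is built on a derivative that defaults to 0. -/
theorem differentiableAt_grad_angle_sq {G : E → Sol3}
    (hG : ∀ᶠ x in 𝓝 y, ∀ i, G x ⬝ᵥ a i x = fderiv ℝ (fun z => n z 2 ^ 2) x (b i))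
    (hGn : ∀ᶠ x in 𝓝 y, G x ⬝ᵥ n x = 0) : DifferentiableAt ℝ G y := by
  refine h.differentiableAt_of_dotProduct hframe (fun j => ?_) ?_
  · exact ((h.differentiableAt_angle_mul_fderiv_angle j).const_mul 2).congr_of_eventuallyEq
      (h.eventuallyEq_grad_angle_sq hG j)
  · exact (differentiableAt_const (0 : ℝ)).congr_of_eventuallyEq hGn

/-- The product rule on G·aᵢ = 2ν₃∂ᵢν₃. The correction G·∇̄ᵢaᵢ, nonzero in general because the
coordinates are not normal, involves only a₀ and a₁ as G is tangent; it completes ∂ᵢ∂ᵢν₃ to the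
Hessian. -/
theorem framedDeriv_grad_angle_sq {G : E → Sol3}
    (hG : ∀ᶠ x in 𝓝 y, ∀ i, G x ⬝ᵥ a i x = fderiv ℝ (fun z => n z 2 ^ 2) x (b i))
    (hGn : ∀ᶠ x in 𝓝 y, G x ⬝ᵥ n x = 0) (i : Fin 2) :
    framedDeriv (a i) (b i) G y ⬝ᵥ a i y =
      2 * (fderiv ℝ (fun z => n z 2) y (b i) ^ 2
        + n y 2 * (fderiv ℝ (fun x => fderiv ℝ (fun z => n z 2) x (b i)) y (b i)
          - fderiv ℝ (fun z => n z 2) y (b 0) * (framedDeriv (a i) (b i) (a i) y ⬝ᵥ a 0 y)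
          - fderiv ℝ (fun z => n z 2) y (b 1) * (framedDeriv (a i) (b i) (a i) y ⬝ᵥ a 1 y))) := by
  have hν : ContDiffAt ℝ ∞ (fun z => n z 2) y := contDiffAt_pi.1 h.contDiffAt_normal 2
  have hνd : DifferentiableAt ℝ (fun z => n z 2) y := hν.differentiableAt (by simp)
  have hνdd : ∀ j, DifferentiableAt ℝ (fun x => fderiv ℝ (fun z => n z 2) x (b j)) y := fun j =>
    (ContDiffAt.fderiv_const_apply hν (b j)).differentiableAt (by simp)
  have hG' := h.eventuallyEq_grad_angle_sq hG
  have hd := h.differentiableAt_grad_angle_sq hframe hG hGn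
  have hGy : ∀ j, G y ⬝ᵥ a j y = 2 * (n y 2 * fderiv ℝ (fun z => n z 2) y (b j)) :=
    fun j => (hG' j).self_of_nhds
  rw [h.framedDeriv_dotProduct_tangent hd, hframe.dotProduct_eq (G y), hGy 0, hGy 1, hGn.self_of_nhds, (hG' i).fderiv_eq,
    fderiv_const_mul (hνd.fun_mul (hνdd i)), fderiv_fun_mul hνd (hνdd i)]
  simp
  ring

theorem differentiableAt_meanCurvature_smul_tangentPart {f : E → ℝ} (hf : h.IsMeanCurvature f)
    {X : E → Sol3}
    (hX : ∀ᶠ x in 𝓝 y, X x = (f x * n x 2) • (Pi.single 2 1 - n x 2 • n x)) :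
    DifferentiableAt ℝ X y := by
  have hfd := h.differentiableAt_meanCurvature hframe hf
  have hn := h.differentiableAt_normal
  have hνd : DifferentiableAt ℝ (fun z => n z 2) y := differentiableAt_pi.1 hn 2
  refine DifferentiableAt.congr_of_eventuallyEq ?_ hX
  fun_prop

/-- Near y, X·aᵢ = fν₃⟨aᵢ, E₃⟩. The third component of ∇̄ᵢaᵢ appears in its derivative and again in
X·∇̄ᵢaᵢ, and cancels; a connection term and ν₃ times the second fundamental form remain. -/
theorem framedDeriv_meanCurvature_smul_tangentPart {f : E → ℝ} (hf : h.IsMeanCurvature f)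
    {X : E → Sol3}
    (hX : ∀ᶠ x in 𝓝 y, X x = (f x * n x 2) • (Pi.single 2 1 - n x 2 • n x)) (i : Fin 2) :
    framedDeriv (a i) (b i) X y ⬝ᵥ a i y =
      (fderiv ℝ f y (b i) * n y 2 + f y * fderiv ℝ (fun z => n z 2) y (b i)) * a i y 2
        + f y * n y 2 * (a i y 0 ^ 2 - a i y 1 ^ 2 + n y 2 * (framedShape a b n i y ⬝ᵥ a i y)) := by
  have hfd := h.differentiableAt_meanCurvature hframe hf
  have hn := h.differentiableAt_normal
  have hνd : DifferentiableAt ℝ (fun z => n z 2) y := differentiableAt_pi.1 hn 2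
  have ha : DifferentiableAt ℝ (fun z => a i z 2) y :=
    differentiableAt_pi.1 (h.differentiableAt_tangent i) 2
  have hd := h.differentiableAt_meanCurvature_smul_tangentPart hframe hf hX
  have hXa : (fun x => X x ⬝ᵥ a i x) =ᶠ[𝓝 y] fun x => f x * n x 2 * a i x 2 := by
    filter_upwards [hX, h.normal] with x hx hnx
    rw [hx, smul_dotProduct, sub_dotProduct, smul_dotProduct, hnx i]
    simp
  rw [h.framedDeriv_dotProduct_tangent hd, hXa.fderiv_eq, hX.self_of_nhds,
    h.eventually_shape_dotProduct_tangent.self_of_nhds, fderiv_fun_mul (hfd.fun_mul hνd) ha,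
    fderiv_fun_mul hfd hνd, smul_dotProduct, sub_dotProduct, smul_dotProduct,
    dotProduct_comm (n y)]
  simp only [_root_.add_apply, _root_.smul_apply, smul_eq_mul,
    fderiv_component (h.differentiableAt_tangent i), fderiv_eq_framedDeriv_sub (a i)]
  simp [frameConnection]
  ring

/-- The Bochner type formula for the square of the angle function `ν₃`, in a coordinate frame that
is orthonormal at the given point. -/
theorem bochner_angle_sq {f : E → ℝ} (hf : h.IsMeanCurvature f) {G X : E → Sol3}
    (hG : ∀ᶠ x in 𝓝 y, ∀ i, G x ⬝ᵥ a i x = fderiv ℝ (fun z => n z 2 ^ 2) x (b i))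
    (hGn : ∀ᶠ x in 𝓝 y, G x ⬝ᵥ n x = 0)
    (hX : ∀ᶠ x in 𝓝 y, X x = (f x * n x 2) • (Pi.single 2 1 - n x 2 • n x)) :
    (1 / 2) * (framedDeriv (a 0) (b 0) G y ⬝ᵥ a 0 y + framedDeriv (a 1) (b 1) G y ⬝ᵥ a 1 y) =
      -(framedDeriv (a 0) (b 0) X y ⬝ᵥ a 0 y + framedDeriv (a 1) (b 1) X y ⬝ᵥ a 1 y)
        - n y 2 * (fderiv ℝ f y (b 0) * a 0 y 2 + fderiv ℝ f y (b 1) * a 1 y 2)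
        + 2 * n y 2 * (a 0 y 1 * framedShape a b n 0 y 1 + a 1 y 1 * framedShape a b n 1 y 1)
        - 2 * n y 2 * (a 0 y 0 * framedShape a b n 0 y 0 + a 1 y 0 * framedShape a b n 1 y 0)
        + 2 * n y 1 * (a 0 y 2 * framedShape a b n 0 y 1 + a 1 y 2 * framedShape a b n 1 y 1)
        - 2 * n y 0 * (a 0 y 2 * framedShape a b n 0 y 0 + a 1 y 2 * framedShape a b n 1 y 0)
        + n y 2 ^ 2 * (2 * f y ^ 2 - 3 - (framedShape a b n 0 y ⬝ᵥ framedShape a b n 0 y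
          + framedShape a b n 1 y ⬝ᵥ framedShape a b n 1 y))
        - f y * (a 0 y 2 * framedShape a b n 0 y 2 + a 1 y 2 * framedShape a b n 1 y 2)
        + (a 0 y 2 • framedShape a b n 0 y + a 1 y 2 • framedShape a b n 1 y) ⬝ᵥ
          (a 0 y 2 • framedShape a b n 0 y + a 1 y 2 • framedShape a b n 1 y)
        + 1 - (n y 1 ^ 2 - n y 0 ^ 2) ^ 2 := by
  have hαn := h.eventually_shape_dotProduct_normal.self_of_nhds
  have hαa := h.eventually_shape_dotProduct_tangent.self_of_nhds
  have hν := h.eventually_fderiv_angle.self_of_nhds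
  have ht := h.torsion.self_of_nhds 1 0
  have hf' : 2 * f y = framedShape a b n 0 y ⬝ᵥ a 0 y + framedShape a b n 1 y ⬝ᵥ a 1 y := by
    have := hf.self_of_nhds
    rw [hframe.uu, hframe.vv, hframe.uv] at this
    linarith
  have hs₀ := h.fderiv_shape_symm 0 0 1
  have hs₁ := h.fderiv_shape_symm 1 0 1
  have hF₀ := h.fderiv_meanCurvature hframe hf 0
  have hF₁ := h.fderiv_meanCurvature hframe hf 1
  have h₁₀ := hαa 1 0
  rw [ht] at hs₁ hF₁ h₁₀
  have hL := angle_laplacian_algebra hframe (hαn 0) (hαn 1) (hαa 0 0) (hαa 0 1) h₁₀ (hαa 1 1)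
    (h.framedDeriv_shape_dotProduct_normal 0 0) (h.framedDeriv_shape_dotProduct_normal 1 1)
    hs₀ hs₁ h.codazzi hf' hF₀ hF₁ (hν 0) (hν 1) (h.fderiv_fderiv_angle 0)
    (h.fderiv_fderiv_angle 1)
  rw [← angle_sq_algebra hframe (hαn 0) (hαn 1) (h.eventually_shape_symm.self_of_nhds 0 1) hf'
    (hν 0) (hν 1) hL (h.framedDeriv_meanCurvature_smul_tangentPart hframe hf hX 0)
    (h.framedDeriv_meanCurvature_smul_tangentPart hframe hf hX 1),
    h.framedDeriv_grad_angle_sq hframe hG hGn 0, h.framedDeriv_grad_angle_sq hframe hG hGn 1]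
  ring

end FramedSurface

/-! ### Passage from the coordinate frame to the frame E -/

variable {E : Type*} [NormedAddCommGroup E] [NormedSpace ℝ E]

theorem christoffelMap_comm (x v w : Sol3) : christoffelMap x w v = christoffelMap x v w := by
  rw [christoffelMap_apply, christoffelMap_apply]
  ext k
  fin_cases k <;> simp <;> ring

theorem ContDiffAt.toFrame {Φ W : E → Sol3} {y : E} {m : ℕ∞ω} (hΦ : ContDiffAt ℝ m Φ y)
    (hW : ContDiffAt ℝ m W y) : ContDiffAt ℝ m (fun x => toFrame (Φ x) (W x)) y := by
  have hΦ' := contDiffAt_pi.1 hΦ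
  have hW' := contDiffAt_pi.1 hW
  rw [contDiffAt_pi]
  intro k
  fin_cases k
  · simpa using (hΦ' 2).exp.mul (hW' 0)
  · simpa using (hΦ' 2).neg.exp.mul (hW' 1)
  · simpa using hW' 2

theorem differentiableAt_of_toFrame {Φ W : E → Sol3} {y : E} (hΦ : DifferentiableAt ℝ Φ y)
    (hW : DifferentiableAt ℝ (fun x => toFrame (Φ x) (W x)) y) : DifferentiableAt ℝ W y := by
  have hΦ' := differentiableAt_pi.1 hΦ
  have hW' := differentiableAt_pi.1 hW
  simp only [toFrame_apply] at hW'
  have h0 := hW' 0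
  have h1 := hW' 1
  have h2 := hW' 2
  simp only [Matrix.cons_val] at h0 h1 h2
  rw [differentiableAt_pi]
  intro k
  fin_cases k
  · refine ((hΦ' 2).neg.exp.mul h0).congr_of_eventuallyEq (.of_forall fun x => ?_)
    simp [← mul_assoc, ← Real.exp_add]
  · refine ((hΦ' 2).exp.mul h1).congr_of_eventuallyEq (.of_forall fun x => ?_)
    simp [← mul_assoc, ← Real.exp_add]
  · exact h2

/-- The Levi-Civita connection of `Sol₃` in the frame `E`. -/
theorem framedDeriv_toFrame {Φ W : E → Sol3} {y : E} (hΦ : DifferentiableAt ℝ Φ y)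
    (hW : DifferentiableAt ℝ W y) (b : E) (a : E → Sol3) (ha : a y = toFrame (Φ y) (fderiv ℝ Φ y b)) :
    framedDeriv a b (fun x => toFrame (Φ x) (W x)) y =
      toFrame (Φ y) (fderiv ℝ W y b + christoffelMap (Φ y) (W y) (fderiv ℝ Φ y b)) := by
  have hΦ' := differentiableAt_pi.1 hΦ
  have hW' := differentiableAt_pi.1 hW
  have hexp : HasFDerivAt (fun x => Real.exp (Φ x 2)) _ y := (hΦ' 2).hasFDerivAt.exp
  have hexpn : HasFDerivAt (fun x => Real.exp (-(Φ x 2))) _ y := (hΦ' 2).hasFDerivAt.fun_neg.exp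
  have hd : DifferentiableAt ℝ (fun x => toFrame (Φ x) (W x)) y := by
    rw [differentiableAt_pi]
    intro k
    fin_cases k <;> simp <;> fun_prop
  have h2 : Real.exp (2 * Φ y 2) = Real.exp (Φ y 2) * Real.exp (Φ y 2) := exp_two_mul_eq _
  have h2n : Real.exp (-(2 * Φ y 2)) = Real.exp (-(Φ y 2)) * Real.exp (-(Φ y 2)) := by
    rw [← exp_two_mul_eq]; ring_nf
  ext k
  rw [framedDeriv_apply, Pi.add_apply, ← fderiv_component hd, ha, christoffelMap_apply]
  fin_cases k
  · simp only [Fin.zero_eta, toFrame_apply_zero, frameConnection, Matrix.cons_val_zero, Pi.add_apply,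
      toFrame_apply_two]
    rw [fderiv_fun_mul hexp.differentiableAt (hW' 0), hexp.fderiv]
    simp [fderiv_component hΦ, fderiv_component hW]
    ring
  · simp only [Fin.mk_one, toFrame_apply_one, frameConnection, Matrix.cons_val_one,
      Matrix.cons_val_zero, Pi.add_apply, toFrame_apply_two]
    rw [fderiv_fun_mul hexpn.differentiableAt (hW' 1), hexpn.fderiv]
    simp [fderiv_component hΦ, fderiv_component hW]
    ring
  · simp only [Fin.reduceFinMk, toFrame_apply_two, frameConnection, Matrix.cons_val, Pi.add_apply,
      fderiv_component hW, toFrame_apply_zero, toFrame_apply_one, h2, h2n]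
    ring

end Sol3

/-! ### Derivatives on the surface read in a chart -/

namespace SolSurface

open Sol3 Filter Topology

variable {M : Type*} [TopologicalSpace M] [ChartedSpace (EuclideanSpace ℝ (Fin 2)) M]

/-- A function on the surface read in the chart at `p`. -/
def inChart {F : Type*} (p : M) (W : M → F) : EuclideanSpace ℝ (Fin 2) → F :=
  W ∘ (extChartAt (𝓡 2) p).symm

variable {F : Type*} [NormedAddCommGroup F] [NormedSpace ℝ F]

theorem eventually_mem_target (p : M) :
    ∀ᶠ y in 𝓝 (extChartAt (𝓡 2) p p), y ∈ (extChartAt (𝓡 2) p).target :=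
  extChartAt_target_mem_nhds p

theorem inChart_extChartAt {F : Type*} (p : M) (W : M → F) {q : M}
    (hq : q ∈ (extChartAt (𝓡 2) p).source) : inChart p W (extChartAt (𝓡 2) p q) = W q := by
  rw [inChart, Function.comp_apply, (extChartAt (𝓡 2) p).left_inv hq]

theorem eventuallyEq_inChart_comp {F : Type*} (p : M) (W : M → F) {q : M}
    (hq : q ∈ (extChartAt (𝓡 2) p).source) : W =ᶠ[𝓝 q] inChart p W ∘ extChartAt (𝓡 2) p := by
  filter_upwards [(isOpen_extChartAt_source p).mem_nhds hq] with z hz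
  exact (inChart_extChartAt p W hz).symm

variable [IsManifold (𝓡 2) ∞ M]

theorem mdifferentiableAt_extChartAt_of_mem (p : M) {q : M}
    (hq : q ∈ (extChartAt (𝓡 2) p).source) :
    MDifferentiableAt (𝓡 2) 𝓘(ℝ, EuclideanSpace ℝ (Fin 2)) (extChartAt (𝓡 2) p) q := by
  have : IsManifold (𝓡 2) 1 M := IsManifold.of_le (n := ∞) (by simp)
  exact mdifferentiableAt_extChartAt (by rwa [extChartAt_source] at hq)

theorem mfderiv_eq_fderiv_inChart {p : M} {W : M → F} {q : M}
    (hq : q ∈ (extChartAt (𝓡 2) p).source)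
    (hW : DifferentiableAt ℝ (inChart p W) (extChartAt (𝓡 2) p q)) (v : TangentSpace (𝓡 2) q) :
    mfderiv (𝓡 2) 𝓘(ℝ, F) W q v = fderiv ℝ (inChart p W) (extChartAt (𝓡 2) p q)
      (mfderiv (𝓡 2) 𝓘(ℝ, EuclideanSpace ℝ (Fin 2)) (extChartAt (𝓡 2) p) q v) := by
  rw [(eventuallyEq_inChart_comp p W hq).mfderiv_eq,
    mfderiv_comp q hW.mdifferentiableAt (mdifferentiableAt_extChartAt_of_mem p hq),
    mfderiv_eq_fderiv]
  rfl

theorem contDiffAt_inChart {W : M → F} (hW : ContMDiff (𝓡 2) 𝓘(ℝ, F) ∞ W) (p : M)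
    {y : EuclideanSpace ℝ (Fin 2)} (hy : y ∈ (extChartAt (𝓡 2) p).target) :
    ContDiffAt ℝ ∞ (inChart p W) y := by
  have h := (contMDiffOn_extChartAt_symm (I := 𝓡 2) (n := ∞) p).contMDiffAt
    ((isOpen_extChartAt_target p).mem_nhds hy)
  exact contMDiffAt_iff_contDiffAt.1 (hW.contMDiffAt.comp y h)

/-- A basis of the model space, transported to a tangent space by a chart. -/
theorem exists_basis_mfderiv_extChartAt {p q : M} (hq : q ∈ (extChartAt (𝓡 2) p).source)
    (b : Module.Basis (Fin 2) ℝ (EuclideanSpace ℝ (Fin 2))) :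
    ∃ V : Module.Basis (Fin 2) ℝ (TangentSpace (𝓡 2) q), ∀ i,
      mfderiv (𝓡 2) 𝓘(ℝ, EuclideanSpace ℝ (Fin 2)) (extChartAt (𝓡 2) p) q (V i) = b i := by
  have : IsManifold (𝓡 2) 1 M := IsManifold.of_le (n := ∞) (by simp)
  obtain ⟨e, he⟩ := isInvertible_mfderiv_extChartAt (I := 𝓡 2) hq
  refine ⟨b.map e.symm.toLinearEquiv, fun i => ?_⟩
  rw [← he]
  exact e.apply_symm_apply (b i)

/-- A basis of a tangent space, transported to the model space by the chart. -/
theorem exists_basis_eq_mfderiv_extChartAt {p : M}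
    (V : Module.Basis (Fin 2) ℝ (TangentSpace (𝓡 2) p)) :
    ∃ b : Module.Basis (Fin 2) ℝ (EuclideanSpace ℝ (Fin 2)), ∀ i,
      mfderiv (𝓡 2) 𝓘(ℝ, EuclideanSpace ℝ (Fin 2)) (extChartAt (𝓡 2) p) p (V i) = b i := by
  have : IsManifold (𝓡 2) 1 M := IsManifold.of_le (n := ∞) (by simp)
  obtain ⟨e, he⟩ := isInvertible_mfderiv_extChartAt (I := 𝓡 2) (mem_extChartAt_source (I := 𝓡 2) p)
  exact ⟨V.map e.toLinearEquiv, fun i => by rw [← he]; rfl⟩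

end SolSurface

/-! ### The surface as a framed surface -/

namespace SolSurface

open Sol3 Filter Topology

variable {M : Type*} [TopologicalSpace M] [ChartedSpace (EuclideanSpace ℝ (Fin 2)) M]

/-- The frame components of a vector field along `φ`, read in the chart at `p`. -/
def inFrame (φ : M → Sol3) (p : M) (W : M → Sol3) (y : EuclideanSpace ℝ (Fin 2)) : Sol3 :=
  toFrame (inChart p φ y) (inChart p W y)

/-- The frame components of the derivative of `φ`, read in the chart at `p`, in direction `b`. -/
def tangentInFrame (φ : M → Sol3) (p : M) (b y : EuclideanSpace ℝ (Fin 2)) : Sol3 :=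
  toFrame (inChart p φ y) (fderiv ℝ (inChart p φ) y b)

theorem inFrame_extChartAt (φ W : M → Sol3) (p : M) {q : M}
    (hq : q ∈ (extChartAt (𝓡 2) p).source) :
    inFrame φ p W (extChartAt (𝓡 2) p q) = toFrame (φ q) (W q) := by
  rw [inFrame, inChart_extChartAt p φ hq, inChart_extChartAt p W hq]

/-- A property of points near `p`, read in the chart at `p`. -/
theorem eventually_inChart_of_source {p : M} {P : EuclideanSpace ℝ (Fin 2) → Prop}
    (h : ∀ q ∈ (extChartAt (𝓡 2) p).source, P (extChartAt (𝓡 2) p q)) :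
    ∀ᶠ y in 𝓝 (extChartAt (𝓡 2) p p), P y := by
  filter_upwards [eventually_mem_target p] with y hy
  have := h _ ((extChartAt (𝓡 2) p).map_target hy)
  rwa [(extChartAt (𝓡 2) p).right_inv hy] at this

theorem angle_inChart {φ ξ : M → Sol3} (hξ : IsUnitNormal φ ξ) (p : M) (k : Fin 3) :
    inChart p (angle φ ξ k) =ᶠ[𝓝 (extChartAt (𝓡 2) p p)] fun y => inFrame φ p ξ y k :=
  eventually_inChart_of_source fun q hq => by
    show _ = inFrame φ p ξ _ k
    rw [inChart_extChartAt p _ hq, inFrame_extChartAt φ ξ p hq, angle_eq_toFrame hξ]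

variable [IsManifold (𝓡 2) ∞ M] {φ : M → Sol3} (hφ : ContMDiff (𝓡 2) 𝓘(ℝ, Sol3) ∞ φ)
include hφ

theorem differentiableAt_inChart {p q : M} (hq : q ∈ (extChartAt (𝓡 2) p).source) :
    DifferentiableAt ℝ (inChart p φ) (extChartAt (𝓡 2) p q) :=
  (contDiffAt_inChart hφ p ((extChartAt (𝓡 2) p).map_source hq)).differentiableAt (by simp)

theorem toFrame_differential {p q : M} (hq : q ∈ (extChartAt (𝓡 2) p).source)
    {v : TangentSpace (𝓡 2) q} {b : EuclideanSpace ℝ (Fin 2)}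
    (hv : mfderiv (𝓡 2) 𝓘(ℝ, EuclideanSpace ℝ (Fin 2)) (extChartAt (𝓡 2) p) q v = b) :
    toFrame (φ q) (differential φ q v) = tangentInFrame φ p b (extChartAt (𝓡 2) p q) := by
  have h := mfderiv_eq_fderiv_inChart hq (differentiableAt_inChart hφ hq) v
  rw [hv] at h
  rw [tangentInFrame, inChart_extChartAt p φ hq, ← h]
  rfl

theorem toFrame_covDerivAlong {p q : M} (hq : q ∈ (extChartAt (𝓡 2) p).source)
    {v : TangentSpace (𝓡 2) q} {b : EuclideanSpace ℝ (Fin 2)}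
    (hv : mfderiv (𝓡 2) 𝓘(ℝ, EuclideanSpace ℝ (Fin 2)) (extChartAt (𝓡 2) p) q v = b)
    {W : M → Sol3} (hW : DifferentiableAt ℝ (inChart p W) (extChartAt (𝓡 2) p q)) :
    toFrame (φ q) (covDerivAlong φ W q v) =
      framedDeriv (tangentInFrame φ p b) b (inFrame φ p W) (extChartAt (𝓡 2) p q) := by
  have hφq := differentiableAt_inChart hφ hq
  have h := mfderiv_eq_fderiv_inChart hq hW v
  have h' := mfderiv_eq_fderiv_inChart hq hφq v
  rw [hv] at h h'
  have key := framedDeriv_toFrame hφq hW b (tangentInFrame φ p b) rfl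
  rw [inChart_extChartAt p φ hq, inChart_extChartAt p W hq, ← h, ← h'] at key
  exact key.symm

theorem differentiableAt_inChart_of_inFrame {p q : M} (hq : q ∈ (extChartAt (𝓡 2) p).source)
    {W : M → Sol3} (hW : DifferentiableAt ℝ (inFrame φ p W) (extChartAt (𝓡 2) p q)) :
    DifferentiableAt ℝ (inChart p W) (extChartAt (𝓡 2) p q) :=
  differentiableAt_of_toFrame (differentiableAt_inChart hφ hq) hW

theorem inFrame_grad_dotProduct_tangent
    (himm : ∀ p, Function.Injective (differential φ p)) (p : M)
    (b : Module.Basis (Fin 2) ℝ (EuclideanSpace ℝ (Fin 2))) {u : M → ℝ}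
    (hu : ContDiffAt ℝ ∞ (inChart p u) (extChartAt (𝓡 2) p p)) :
    ∀ᶠ y in 𝓝 (extChartAt (𝓡 2) p p), ∀ i,
      inFrame φ p (fun q => differential φ q (grad φ u q)) y ⬝ᵥ tangentInFrame φ p (b i) y =
        fderiv ℝ (inChart p u) y (b i) := by
  filter_upwards [ContDiffAt.eventually_differentiableAt hu, eventually_mem_target p] with y hy ht i
  obtain ⟨q, hq, rfl⟩ : ∃ q ∈ (extChartAt (𝓡 2) p).source, extChartAt (𝓡 2) p q = y :=
    ⟨_, (extChartAt (𝓡 2) p).map_target ht, (extChartAt (𝓡 2) p).right_inv ht⟩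
  obtain ⟨V, hV⟩ := exists_basis_mfderiv_extChartAt hq b
  rw [inFrame_extChartAt _ _ p hq, ← toFrame_differential hφ hq (hV i), ← metric_eq_dotProduct,
    ← inducedMetric_apply, inducedMetric_grad (himm q), mfderiv_eq_fderiv_inChart hq hy, hV]

variable {ξ : M → Sol3} (hξ : IsUnitNormal φ ξ)
include hξ

/-- A surface with a unit normal, read in the chart at `p` and in the frame `E`. -/
theorem framedSurface (p : M) (b : Module.Basis (Fin 2) ℝ (EuclideanSpace ℝ (Fin 2))) :
    FramedSurface (fun i => tangentInFrame φ p (b i)) b (inFrame φ p ξ) (extChartAt (𝓡 2) p p) where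
  contDiffAt_tangent i :=
    have h := contDiffAt_inChart hφ p (mem_extChartAt_target (I := 𝓡 2) p)
    ContDiffAt.toFrame h (ContDiffAt.fderiv_const_apply h (b i))
  contDiffAt_normal := ContDiffAt.toFrame
    (contDiffAt_inChart hφ p (mem_extChartAt_target (I := 𝓡 2) p))
    (contDiffAt_inChart hξ.smooth p (mem_extChartAt_target (I := 𝓡 2) p))
  unit := eventually_inChart_of_source fun q hq => by
    rw [inFrame_extChartAt φ ξ p hq, ← metric_eq_dotProduct, hξ.unit]
  normal := eventually_inChart_of_source fun q hq i => by
    obtain ⟨V, hV⟩ := exists_basis_mfderiv_extChartAt hq b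
    rw [inFrame_extChartAt φ ξ p hq, ← toFrame_differential hφ hq (hV i), ← metric_eq_dotProduct,
      hξ.normal]
  torsion := eventually_inChart_of_source fun q hq i j => by
    have h := contDiffAt_inChart hφ p ((extChartAt (𝓡 2) p).map_source hq)
    have hd := h.differentiableAt (by simp)
    have hs : IsSymmSndFDerivAt ℝ (inChart p φ) (extChartAt (𝓡 2) p q) :=
      h.isSymmSndFDerivAt (by
        rw [minSmoothness_of_isRCLikeNormedField]
        exact WithTop.coe_le_coe.2 le_top)
    have hdd : DifferentiableAt ℝ (fderiv ℝ (inChart p φ)) (extChartAt (𝓡 2) p q) :=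
      (h.fderiv_right (m := ∞) (by simp)).differentiableAt (by simp)
    have key : ∀ k l, framedDeriv (tangentInFrame φ p (b k)) (b k) (tangentInFrame φ p (b l))
        (extChartAt (𝓡 2) p q) = _ := fun k l =>
      framedDeriv_toFrame hd ((ContDiffAt.fderiv_const_apply h (b l)).differentiableAt (by simp))
        (b k) (tangentInFrame φ p (b k)) rfl
    have hsnd : ∀ k l, fderiv ℝ (fun y => fderiv ℝ (inChart p φ) y (b l)) (extChartAt (𝓡 2) p q) (b k)
        = fderiv ℝ (fderiv ℝ (inChart p φ)) (extChartAt (𝓡 2) p q) (b k) (b l) := fun k l => by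
      rw [fderiv_clm_apply hdd (by fun_prop)]
      simp
    -- Both parts of ∇̄ₖ∂ₗφ are symmetric in k and l: the second derivative of φ and the Christoffel
    -- term.
    rw [key, key, hsnd, hsnd, hs.eq, christoffelMap_comm]

theorem framedShape_eq {p q : M} (hq : q ∈ (extChartAt (𝓡 2) p).source)
    (b : Module.Basis (Fin 2) ℝ (EuclideanSpace ℝ (Fin 2))) {i : Fin 2}
    {v : TangentSpace (𝓡 2) q}
    (hv : mfderiv (𝓡 2) 𝓘(ℝ, EuclideanSpace ℝ (Fin 2)) (extChartAt (𝓡 2) p) q v = b i) :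
    framedShape (fun i => tangentInFrame φ p (b i)) b (inFrame φ p ξ) i (extChartAt (𝓡 2) p q) =
      -toFrame (φ q) (covDerivAlong φ ξ q v) := by
  rw [framedShape, toFrame_covDerivAlong hφ hq hv (differentiableAt_inChart hξ.smooth hq)]

variable (himm : ∀ p, Function.Injective (differential φ p))
include himm

theorem inducedMetric_shapeOperator {p q : M} (hq : q ∈ (extChartAt (𝓡 2) p).source)
    (b : Module.Basis (Fin 2) ℝ (EuclideanSpace ℝ (Fin 2))) {i : Fin 2}
    {v : TangentSpace (𝓡 2) q}
    (hv : mfderiv (𝓡 2) 𝓘(ℝ, EuclideanSpace ℝ (Fin 2)) (extChartAt (𝓡 2) p) q v = b i)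
    (w : TangentSpace (𝓡 2) q) :
    inducedMetric φ q (shapeOperator φ ξ q v) w =
      framedShape (fun i => tangentInFrame φ p (b i)) b (inFrame φ p ξ) i (extChartAt (𝓡 2) p q) ⬝ᵥ
        toFrame (φ q) (differential φ q w) := by
  rw [framedShape_eq hφ hξ hq b hv, neg_dotProduct, ← metric_eq_dotProduct,
    ← inducedMetric_tangentPart (himm q)]
  simp [shapeOperator]

/-- The tangential projection in `shapeOperator` loses nothing, as ∇̄ξ is orthogonal to ξ. -/
theorem toFrame_differential_shapeOperator {p : M}
    (b : Module.Basis (Fin 2) ℝ (EuclideanSpace ℝ (Fin 2))) {i : Fin 2}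
    {v : TangentSpace (𝓡 2) p}
    (hv : mfderiv (𝓡 2) 𝓘(ℝ, EuclideanSpace ℝ (Fin 2)) (extChartAt (𝓡 2) p) p v = b i) :
    toFrame (φ p) (differential φ p (shapeOperator φ ξ p v)) =
      framedShape (fun i => tangentInFrame φ p (b i)) b (inFrame φ p ξ) i
        (extChartAt (𝓡 2) p p) := by
  have hp := mem_extChartAt_source (I := 𝓡 2) p
  have h := (framedSurface hφ hξ p b).eventually_shape_dotProduct_normal.self_of_nhds i
  rw [framedShape_eq hφ hξ hp b hv, inFrame_extChartAt φ ξ p hp, neg_dotProduct, dotProduct_comm,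
    ← metric_eq_dotProduct, neg_eq_zero] at h
  rw [framedShape_eq hφ hξ hp b hv]
  simp [shapeOperator, differential_tangentPart (himm p) (hξ.unit p) (hξ.normal p) h]

theorem isMeanCurvature_inChart (p : M)
    (b : Module.Basis (Fin 2) ℝ (EuclideanSpace ℝ (Fin 2))) :
    (framedSurface hφ hξ p b).IsMeanCurvature (inChart p (meanCurvature φ ξ)) :=
  eventually_inChart_of_source fun q hq => by
    obtain ⟨V, hV⟩ := exists_basis_mfderiv_extChartAt hq b
    have h := LinearMap.trace_mul_gram_eq (inducedMetric φ q) (inducedMetric_comm φ q) V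
      (shapeOperator φ ξ q)
    have hg : ∀ i j, inducedMetric φ q (V i) (V j) =
        tangentInFrame φ p (b i) (extChartAt (𝓡 2) p q) ⬝ᵥ
          tangentInFrame φ p (b j) (extChartAt (𝓡 2) p q) := fun i j => by
      rw [inducedMetric_apply, metric_eq_dotProduct, toFrame_differential hφ hq (hV i),
        toFrame_differential hφ hq (hV j)]
    have hA : ∀ i j, inducedMetric φ q (shapeOperator φ ξ q (V i)) (V j) = _ := fun i j =>
      inducedMetric_shapeOperator hφ hξ himm hq b (hV i) (V j)
    simp only [hg, hA, toFrame_differential hφ hq (hV _)] at h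
    rw [inChart_extChartAt p _ hq, ← h, meanCurvature]
    ring

end SolSurface

/-! ### Translation back to the surface and the final formula -/

/-- The expansion of a vector in an orthonormal basis of a plane. -/
theorem LinearMap.eq_sum_of_orthonormal {V : Type*} [AddCommGroup V] [Module ℝ V]
    (g : V →ₗ[ℝ] V →ₗ[ℝ] ℝ) (hg : ∀ u v, g u v = g v u) (b : Module.Basis (Fin 2) ℝ V)
    (h0 : g (b 0) (b 0) = 1) (h1 : g (b 1) (b 1) = 1) (h01 : g (b 0) (b 1) = 0) (v : V) :
    v = g v (b 0) • b 0 + g v (b 1) • b 1 := by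
  have hv := b.sum_repr v
  rw [Fin.sum_univ_two] at hv
  have h10 : g (b 1) (b 0) = 0 := by rw [hg, h01]
  have c0 : g v (b 0) = b.repr v 0 := by
    conv_lhs => rw [← hv]
    simp [h0, h10]
  have c1 : g v (b 1) = b.repr v 1 := by
    conv_lhs => rw [← hv]
    simp [h1, h01]
  rw [c0, c1, hv]

namespace SolSurface

open Sol3 Filter Topology

variable {M : Type*} [TopologicalSpace M] [ChartedSpace (EuclideanSpace ℝ (Fin 2)) M]

theorem inducedMetric_eq_toFrame_apply {φ : M → Sol3} {p : M}
    (himm : Function.Injective (differential φ p)) (v : TangentSpace (𝓡 2) p) (k : Fin 3) :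
    inducedMetric φ p v (ETan φ k p) = toFrame (φ p) (differential φ p v) k := by
  rw [inducedMetric_comm, ETan, inducedMetric_tangentPart himm, metric_eq_dotProduct, toFrame_E]
  simp

theorem toFrame_differential_ETan {φ ξ : M → Sol3} (hξ : IsUnitNormal φ ξ) {p : M}
    (himm : Function.Injective (differential φ p)) (k : Fin 3) :
    toFrame (φ p) (differential φ p (ETan φ k p)) =
      Pi.single k 1 - toFrame (φ p) (ξ p) k • toFrame (φ p) (ξ p) := by
  rw [ETan, differential_tangentPart_eq_sub himm (hξ.unit p) (hξ.normal p), map_sub, map_smul,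
    metric_eq_dotProduct, toFrame_E]
  simp

variable [IsManifold (𝓡 2) ∞ M]

theorem divergence_eq_framedDeriv {φ : M → Sol3} (hφ : ContMDiff (𝓡 2) 𝓘(ℝ, Sol3) ∞ φ) {p : M}
    (himm : Function.Injective (differential φ p))
    (V : Module.Basis (Fin 2) ℝ (TangentSpace (𝓡 2) p))
    (h0 : inducedMetric φ p (V 0) (V 0) = 1) (h1 : inducedMetric φ p (V 1) (V 1) = 1)
    (h01 : inducedMetric φ p (V 0) (V 1) = 0)
    (b : Module.Basis (Fin 2) ℝ (EuclideanSpace ℝ (Fin 2)))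
    (hV : ∀ i, mfderiv (𝓡 2) 𝓘(ℝ, EuclideanSpace ℝ (Fin 2)) (extChartAt (𝓡 2) p) p (V i) = b i)
    (X : ∀ q : M, TangentSpace (𝓡 2) q)
    (hX : DifferentiableAt ℝ (inFrame φ p fun q => differential φ q (X q))
      (extChartAt (𝓡 2) p p)) :
    divergence φ X p =
      framedDeriv (tangentInFrame φ p (b 0)) (b 0) (inFrame φ p fun q => differential φ q (X q))
          (extChartAt (𝓡 2) p p) ⬝ᵥ tangentInFrame φ p (b 0) (extChartAt (𝓡 2) p p)
        + framedDeriv (tangentInFrame φ p (b 1)) (b 1) (inFrame φ p fun q => differential φ q (X q))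
          (extChartAt (𝓡 2) p p) ⬝ᵥ tangentInFrame φ p (b 1) (extChartAt (𝓡 2) p p) := by
  have hp := mem_extChartAt_source (I := 𝓡 2) p
  have hX' := differentiableAt_inChart_of_inFrame hφ hp hX
  rw [divergence_eq_of_orthonormal himm V h0 h1 h01, metric_eq_dotProduct, metric_eq_dotProduct,
    toFrame_covDerivAlong hφ hp (hV 0) hX', toFrame_covDerivAlong hφ hp (hV 1) hX',
    toFrame_differential hφ hp (hV 0), toFrame_differential hφ hp (hV 1)]

end SolSurface

end

open Sol3 SolSurface Filter Topology in
theorem propositionp {M : Type*} [TopologicalSpace M]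
    [ChartedSpace (EuclideanSpace ℝ (Fin 2)) M] [IsManifold (𝓡 2) ∞ M]
    (φ : M → Sol3) (hφ : ContMDiff (𝓡 2) 𝓘(ℝ, Sol3) ∞ φ)
    (himm : ∀ p, Function.Injective (SolSurface.differential φ p))
    (ξ : M → Sol3) (hξ : SolSurface.IsUnitNormal φ ξ) (p : M) :
    let g := SolSurface.inducedMetric φ p
    let A := SolSurface.shapeOperator φ ξ p
    let f := SolSurface.meanCurvature φ ξ
    let ν₁ := SolSurface.angle φ ξ 0
    let ν₂ := SolSurface.angle φ ξ 1
    let ν₃ := SolSurface.angle φ ξ 2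
    let T₁ := SolSurface.ETan φ 0 p
    let T₂ := SolSurface.ETan φ 1 p
    let T₃ := SolSurface.ETan φ 2 p
    (1 / 2) * SolSurface.laplacian φ (fun q => ν₃ q ^ 2) p =
      -SolSurface.divergence φ (fun q => (f q * ν₃ q) • SolSurface.ETan φ 2 q) p
        - ν₃ p * g (SolSurface.grad φ f p) T₃
        + 2 * ν₃ p * g (A T₂) T₂ - 2 * ν₃ p * g (A T₁) T₁
        + 2 * ν₂ p * g (A T₃) T₂ - 2 * ν₁ p * g (A T₃) T₁
        + ν₃ p ^ 2 * (2 * f p ^ 2 - 3 - SolSurface.normSq φ p A)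
        - f p * g (A T₃) T₃ + g (A T₃) (A T₃)
        + 1 - (ν₂ p ^ 2 - ν₁ p ^ 2) ^ 2 := by
  intro g A f ν₁ ν₂ ν₃ T₁ T₂ T₃
  have hp := mem_extChartAt_source (I := 𝓡 2) p
  obtain ⟨V, h0, h1, h01⟩ := LinearMap.exists_orthonormal_basis_fin_two (finrank_tangentSpace p)
    (inducedMetric φ p) (inducedMetric_comm φ p) (inducedMetric_self_pos (himm p))
  -- Pushing an orthonormal basis of T_pM to the model space makes the constant directions `b i`
  -- orthonormal at p, for any chart.
  obtain ⟨b, hV⟩ := exists_basis_eq_mfderiv_extChartAt V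
  have surf := framedSurface hφ hξ p b
  set y := extChartAt (𝓡 2) p p with hy
  set n := inFrame φ p ξ with hn
  set a : Fin 2 → EuclideanSpace ℝ (Fin 2) → Sol3 := fun i => tangentInFrame φ p (b i) with ha
  have hny : n y = toFrame (φ p) (ξ p) := inFrame_extChartAt φ ξ p hp
  have hay : ∀ i, toFrame (φ p) (differential φ p (V i)) = a i y := fun i =>
    toFrame_differential hφ hp (hV i)
  have hgV : ∀ i j, inducedMetric φ p (V i) (V j) = a i y ⬝ᵥ a j y := fun i j => by
    rw [inducedMetric_apply, metric_eq_dotProduct, hay, hay]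
  have hframe : IsOrthonormalFrame (a 0 y) (a 1 y) (n y) :=
    ⟨(hgV 0 0).symm.trans h0, (hgV 1 1).symm.trans h1, surf.unit.self_of_nhds,
      (hgV 0 1).symm.trans h01, surf.normal.self_of_nhds 0, surf.normal.self_of_nhds 1⟩
  have hf : surf.IsMeanCurvature (inChart p f) := isMeanCurvature_inChart hφ hξ himm p b
  have hν : ∀ k, angle φ ξ k p = n y k := fun k => by rw [hny, angle_eq_toFrame hξ]
  have hfp : inChart p f y = f p := inChart_extChartAt p f hp
  -- the gradient of `ν₃ ^ 2` and the field `f ν₃ T₃` along `φ`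
  set G := inFrame φ p fun q => differential φ q (grad φ (fun q => ν₃ q ^ 2) q) with hGdef
  set X := inFrame φ p fun q => differential φ q ((f q * ν₃ q) • ETan φ 2 q) with hXdef
  have hu : inChart p (fun q => ν₃ q ^ 2) =ᶠ[𝓝 y] fun z => n z 2 ^ 2 :=
    (angle_inChart hξ p 2).mono fun z hz => congrArg (· ^ 2) hz
  have hud : ContDiffAt ℝ ∞ (inChart p fun q => ν₃ q ^ 2) y :=
    ((contDiffAt_pi.1 surf.contDiffAt_normal 2).pow 2).congr_of_eventuallyEq hu
  have hG : ∀ᶠ x in 𝓝 y, ∀ i, G x ⬝ᵥ a i x = fderiv ℝ (fun z => n z 2 ^ 2) x (b i) := by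
    filter_upwards [inFrame_grad_dotProduct_tangent hφ himm p b hud,
      eventually_eventually_nhds.2 hu] with x hx hux i
    rw [← EventuallyEq.fderiv_eq hux]
    exact hx i
  have hGn : ∀ᶠ x in 𝓝 y, G x ⬝ᵥ n x = 0 := eventually_inChart_of_source fun q hq => by
    rw [hGdef, hn, inFrame_extChartAt _ _ p hq, inFrame_extChartAt _ _ p hq, dotProduct_comm,
      ← metric_eq_dotProduct, hξ.normal]
  -- T₃ = E₃ - ν₃ξ, and E₃ has constant frame components.
  have hX : ∀ᶠ x in 𝓝 y, X x = (inChart p f x * n x 2) • (Pi.single 2 1 - n x 2 • n x) :=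
    eventually_inChart_of_source fun q hq => by
      rw [hXdef, hn, inFrame_extChartAt _ _ p hq, inFrame_extChartAt _ _ p hq,
        inChart_extChartAt p f hq, map_smul, map_smul, toFrame_differential_ETan hξ (himm q),
        ← angle_eq_toFrame hξ]
  have hmain := surf.bochner_angle_sq hframe hf hG hGn hX
  -- the terms of the formula
  have hlap : laplacian φ (fun q => ν₃ q ^ 2) p = _ :=
    divergence_eq_framedDeriv hφ (himm p) V h0 h1 h01 b hV (grad φ fun q => ν₃ q ^ 2)
      (surf.differentiableAt_grad_angle_sq hframe hG hGn)
  have hdiv : divergence φ (fun q => (f q * ν₃ q) • ETan φ 2 q) p = _ :=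
    divergence_eq_framedDeriv hφ (himm p) V h0 h1 h01 b hV (fun q => (f q * ν₃ q) • ETan φ 2 q)
      (surf.differentiableAt_meanCurvature_smul_tangentPart hframe hf hX)
  -- The coefficient ⟨T_k, Vᵢ⟩ = ⟨E_k, dφ Vᵢ⟩ is the k-th frame component of `a i y`.
  have hT : ∀ k, ETan φ k p = a 0 y k • V 0 + a 1 y k • V 1 := fun k => by
    have h := LinearMap.eq_sum_of_orthonormal _ (inducedMetric_comm φ p) V h0 h1 h01 (ETan φ k p)
    rwa [inducedMetric_comm φ p (ETan φ k p), inducedMetric_comm φ p (ETan φ k p),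
      inducedMetric_eq_toFrame_apply (himm p), inducedMetric_eq_toFrame_apply (himm p), hay,
      hay] at h
  have hAV : ∀ i, toFrame (φ p) (differential φ p (A (V i))) = framedShape a b n i y := fun i =>
    toFrame_differential_shapeOperator hφ hξ himm b (hV i)
  have hAT : ∀ k, toFrame (φ p) (differential φ p (A (ETan φ k p))) =
      a 0 y k • framedShape a b n 0 y + a 1 y k • framedShape a b n 1 y := fun k => by
    rw [hT k, map_add, map_smul, map_smul, map_add, map_smul, map_smul, map_add, map_smul,
      map_smul, hAV, hAV]
  have hgA : ∀ k l, g (A (ETan φ k p)) (ETan φ l p) =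
      a 0 y k * framedShape a b n 0 y l + a 1 y k * framedShape a b n 1 y l := fun k l => by
    rw [inducedMetric_eq_toFrame_apply (himm p), hAT]
    rfl
  have hgAA : g (A T₃) (A T₃) =
      (a 0 y 2 • framedShape a b n 0 y + a 1 y 2 • framedShape a b n 1 y) ⬝ᵥ
        (a 0 y 2 • framedShape a b n 0 y + a 1 y 2 • framedShape a b n 1 y) := by
    rw [inducedMetric_apply, metric_eq_dotProduct, hAT]
  have hnorm : normSq φ p A = framedShape a b n 0 y ⬝ᵥ framedShape a b n 0 y
      + framedShape a b n 1 y ⬝ᵥ framedShape a b n 1 y := by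
    rw [normSq_eq_of_orthonormal (himm p) V h0 h1 h01, inducedMetric_apply, inducedMetric_apply,
      metric_eq_dotProduct, metric_eq_dotProduct, hAV, hAV]
  have hfd := surf.differentiableAt_meanCurvature hframe hf
  have hgrad : g (grad φ f p) T₃ =
      fderiv ℝ (inChart p f) y (b 0) * a 0 y 2 + fderiv ℝ (inChart p f) y (b 1) * a 1 y 2 := by
    have hfV : ∀ i, mfderiv (𝓡 2) 𝓘(ℝ, ℝ) f p (V i) = fderiv ℝ (inChart p f) y (b i) := fun i => by
      rw [mfderiv_eq_fderiv_inChart hp hfd, hV]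
    rw [inducedMetric_grad (himm p), show T₃ = _ from hT 2, map_add, map_smul, map_smul, hfV, hfV]
    change a 0 y 2 * fderiv ℝ (inChart p f) y (b 0) + a 1 y 2 * fderiv ℝ (inChart p f) y (b 1) = _
    ring
  rw [hlap, hdiv, hgAA, hnorm, hgrad, hgA, hgA, hgA, hgA, hgA, show ν₁ p = _ from hν 0,
    show ν₂ p = _ from hν 1, show ν₃ p = _ from hν 2, ← hfp]
  exact hmain
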